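/- A seller has $k$ identical items, and a single surplus-maximizing intermediary represents all $n$ unit-demand buyers (monopsony). The buyers' valuations $v_1,\dots,v_n\ge 0$ are i.i.d. with law $F$ and are all known to the intermediary; $v^{(1,n)}\ge\dots\ge v^{(n,n)}$ are their order statistics. If the intermediary gets $x\in\{0,\dots,k\}$ items for a payment $p$, its utility is $\sum_{j\le x}v^{(j,n)}-p$. A direct mechanism maps the reported vector $\mathbf v$ to a lottery over $\{0,\dots,k\}$ and a payment $p(\mathbf v)\ge 0$; it is required to be measurable, incentive compatible with respect to reports in $(\operatorname{supp}F)^n$ and individually rational, for almost every true $\mathbf v$. Its revenue is $\mathbb E[p(\mathbf v)]$, and $\mathrm{Rev}^M(n,k)$ is the supremum of the revenues of all such mechanisms. Selling the bundle at price $P\ge 0$ is the mechanism under which the intermediary gets all $k$ items and pays $P$ if $\sum_{j\le k}v^{(j,n)}\ge P$, and gets and pays nothing otherwise. This is incentive compatible and individually rational in both parts below. (1) Suppose that $F$ has the monotone hazard rate property: it has a density $f$ which is positive on an interval $(a,b)$, $a<b\le\infty$, and zero outside its closure, and (writing $F$ also for the distribution function) $f/(1-F)$ is nondecreasing on $(a,b)$.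 Let $1\le k\le n$, and let $G$ be the distribution of $\sum_{j=1}^k v^{(j,n)}$. Then $G$ has a density $g$. For every version of $g$, with the virtual valuation $\phi_G(x)=x-\frac{1-G(x)}{g(x)}$, there is a unique price $p_B=\phi_G^{-1}(0)$, i.e. a unique point $p_B$ of the support of $G$ with $\phi_G\le 0$ at $G$-almost every $x<p_B$ and $\phi_G\ge 0$ at $G$-almost every $x>p_B$. Moreover $p_B\ge 0$, and $$p_B\cdot\mathbb P\Big[\sum_{j=1}^k v^{(j,n)}\ge p_B\Big]\ \ge\ \frac1e\,\mathrm{Rev}^M(n,k).$$ (2) Let $F$ be any distribution on $[0,\infty)$ with finite mean $\mathbb E[v]>0$ (not necessarily MHR), let $k=n$, and let $R(n,\varepsilon)$ be the revenue from selling all $n$ items as one bundle at the price $n(\mathbb E[v]-\varepsilon)$. Then for every $0<\varepsilon<\mathbb E[v]$ $$\lim_{n\to\infty}\frac{R(n,\varepsilon)}{\mathrm{Rev}^M(n,n)}=1-\frac{\varepsilon}{\mathbb E[v]}.$$ In particular the bundle price is asymptotically optimal as $n\to\infty$ and $\varepsilon\to0$: for every $\delta>0$ there is $\varepsilon_0>0$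 such that for every $0<\varepsilon<\varepsilon_0$ and all sufficiently large $n$, $R(n,\varepsilon)\ge(1-\delta)\,\mathrm{Rev}^M(n,n)$. -/

import Mathlib

open MeasureTheory ProbabilityTheory Filter Topology
open scoped ENNReal NNReal

noncomputable section

namespace Monopsony

/-! ### Distributions -/

/-- `f` is a (version of the) probability density function of `μ`. -/
structure IsDensity (μ : Measure ℝ) (f : ℝ → ℝ) : Prop where
  measurable : Measurable f
  nonneg : ∀ x, 0 ≤ f x
  eq_withDensity : μ = volume.withDensity (fun x => ENNReal.ofReal (f x))

/-- The hazard rate `f / (1 - F)` of a distribution `μ` with cdf `F` and density `f`. -/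
def hazardRate (μ : Measure ℝ) (f : ℝ → ℝ) (x : ℝ) : ℝ :=
  f x / (1 - cdf μ x)

/-- The virtual valuation `φ(x) = x - (1 - F(x)) / f(x)` of a distribution `μ` with cdf `F` and
density `f`. -/
def virtualValue (μ : Measure ℝ) (f : ℝ → ℝ) (x : ℝ) : ℝ :=
  x - (1 - cdf μ x) / f x

/-- `μ` has the monotone hazard rate property: it has a density which is positive on an interval
`(a, b)`, `a < b ≤ ∞`, zero off its closure, and whose hazard rate is nondecreasing on `(a, b)`. -/
def IsMHR (μ : Measure ℝ) : Prop :=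
  ∃ (a : ℝ) (b : EReal) (f : ℝ → ℝ), (a : EReal) < b ∧ IsDensity μ f ∧
    (∀ x : ℝ, a < x → (x : EReal) < b → 0 < f x) ∧
    (∀ x : ℝ, x < a ∨ b < (x : EReal) → f x = 0) ∧
    MonotoneOn (hazardRate μ f) {x : ℝ | a < x ∧ (x : EReal) < b}

/-- `p = φ⁻¹(0)`, where `φ` is the virtual valuation of `μ` (with density `f`): `p` is the point of
the support of `μ` at which `φ` crosses zero. Here `φ⁻¹` is the generalized inverse, so that `φ`
may jump over zero at `p`, and `p` is the left end of the support if `φ` is positive on all of it.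
The signs are required almost everywhere, because densities are only determined up to null sets. -/
def IsVirtualValueZero (μ : Measure ℝ) (f : ℝ → ℝ) (p : ℝ) : Prop :=
  p ∈ μ.support ∧
    ∀ᵐ x ∂μ, (x < p → virtualValue μ f x ≤ 0) ∧ (p < x → 0 ≤ virtualValue μ f x)

/-! ### Order statistics -/

/-- The order statistics of `v`, from the highest (`j = 0`) to the lowest (`j = n - 1`). -/
def orderStat {n : ℕ} (v : Fin n → ℝ) (j : Fin n) : ℝ :=
  v (Tuple.sort v (Fin.rev j))

/-- The sum of the `k` highest entries of `v`, which is the value of `k` identical items to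
an intermediary who represents unit-demand buyers with valuations `v`. -/
def topSum {n : ℕ} (k : ℕ) (v : Fin n → ℝ) : ℝ :=
  ∑ j : Fin n with j.val < k, orderStat v j

/-- The joint law of `n` independent valuations with law `F`. -/
def valuationLaw (F : Measure ℝ) (n : ℕ) : Measure (Fin n → ℝ) :=
  Measure.pi (fun _ => F)

/-- The law of the sum of the `k` highest of `n` independent valuations with law `F`. -/
def topSumLaw (F : Measure ℝ) (n k : ℕ) : Measure ℝ :=
  (valuationLaw F n).map (topSum k)

/-! ### Mechanisms for a seller of `k` items who faces one intermediary -/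

/-- A direct mechanism: the reported valuation vector is mapped to a lottery over the number of
items, `0, …, k`, that the intermediary gets, and to a nonnegative payment. -/
structure Mechanism (n k : ℕ) where
  alloc : (Fin n → ℝ) → PMF (Fin (k + 1))
  pay : (Fin n → ℝ) → ℝ≥0

/-- Expected utility of the surplus-maximizing intermediary with valuations `v` who reports `w`. -/
def Mechanism.utility {n k : ℕ} (M : Mechanism n k) (v w : Fin n → ℝ) : ℝ :=
  (∑ j : Fin (k + 1), (M.alloc w j).toReal * topSum j.val v) - (M.pay w : ℝ)

/-- Incentive compatible and individually rational measurable mechanisms. The single intermediary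
knows all valuations, so the conditional expectations given its type are plain evaluations. -/
structure Mechanism.IsBIC {n k : ℕ} (F : Measure ℝ) (M : Mechanism n k) : Prop where
  measurable_alloc : ∀ j, Measurable (fun v => M.alloc v j)
  measurable_pay : Measurable M.pay
  ic : ∀ᵐ v ∂(valuationLaw F n), ∀ w : Fin n → ℝ, (∀ i, w i ∈ F.support) →
    M.utility v w ≤ M.utility v v
  ir : ∀ᵐ v ∂(valuationLaw F n), 0 ≤ M.utility v v

/-- Expected revenue of a mechanism. -/
def Mechanism.revenue {n k : ℕ} (F : Measure ℝ) (M : Mechanism n k) : ℝ≥0∞ :=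
  ∫⁻ v, (M.pay v : ℝ≥0∞) ∂(valuationLaw F n)

/-- The optimal revenue: the supremum over all incentive compatible and individually rational
mechanisms. -/
def optRevenue (F : Measure ℝ) (n k : ℕ) : ℝ≥0∞ :=
  ⨆ (M : Mechanism n k) (_ : M.IsBIC F), M.revenue F

/-- All `k` items are offered as one bundle at the price `P`; the intermediary buys the bundle
if its value is at least `P`. -/
def bundleMechanism (n k : ℕ) (P : ℝ≥0) : Mechanism n k where
  alloc v := if (P : ℝ) ≤ topSum k v then PMF.pure (Fin.last k) else PMF.pure 0
  pay v := if (P : ℝ) ≤ topSum k v then P else 0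

end Monopsony

end

noncomputable section

namespace Monopsony

/-! Individual rationality alone bounds the payment by the value of all k items, so the optimal
revenue is at most the mean of `topSum k` (`optRevenue_le_lintegral`). Both parts compare the
revenue of the bundle with this mean.

For k = n the mean is n·E[v], and by the law of large numbers the bundle at price n(E[v] - ε) sells
with probability tending to 1 (`tendsto_valuationLaw_sum_ge`). Letting ε vary shows that the optimal
revenue per buyer tends to E[v].

For MHR valuations the key fact is that the tail G[x, ∞) of the sum is log-concave
(`isLogConcave_survival_topSumLaw`). A monotone hazard rate makes the tail of F log-concave, which
means that F is the image of the exponential law under a function Q that is concave on [0, ∞). On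
decreasing vectors e ≥ 0 the sum of the k highest valuations is Q(e_1) + ... + Q(e_k), a concave
function, so its hypograph is convex. By symmetry the tail of the sum is n! times the integral of
the indicator of this hypograph against a log-concave product density, and a Prékopa argument
(`IsLogConcave.integral_pi`) shows that it is log-concave in the threshold.

A log-concave tail S lies below its tangent exponentials. At the zero p of the virtual value the
rate 1/p is a supporting slope, so S(u) ≤ S(p)·exp(1 - u/p). Integrating over u ≥ 0 bounds the mean
by e·p·S(p), which is e times the revenue of the bundle at price p (`IsRegular.lintegral_le`). -/

/-! ### The sum of the highest valuations -/

/-- The permutation that sorts `v` in decreasing order. -/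
def sortDesc {n : ℕ} (v : Fin n → ℝ) : Equiv.Perm (Fin n) :=
  Fin.revPerm.trans (Tuple.sort v)

lemma antitone_orderStat {n : ℕ} (v : Fin n → ℝ) : Antitone (orderStat v) := fun _ _ h =>
  Tuple.monotone_sort v (Fin.rev_le_rev.2 h)

lemma antitone_comp_sortDesc {n : ℕ} (v : Fin n → ℝ) : Antitone (v ∘ sortDesc v) :=
  antitone_orderStat v

/-- The sum of the first `k` entries of `v`. -/
def headSum {n : ℕ} (k : ℕ) (v : Fin n → ℝ) : ℝ :=
  ∑ j : Fin n with j.val < k, v j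

lemma topSum_eq_headSum {n : ℕ} (k : ℕ) (v : Fin n → ℝ) :
    topSum k v = headSum k (v ∘ sortDesc v) := rfl

/-- This is the rearrangement inequality for v against the weights 1, ..., 1, 0, ..., 0, which
decrease as well. -/
lemma headSum_comp_perm_le {n : ℕ} (k : ℕ) {v : Fin n → ℝ} (hv : Antitone v)
    (σ : Equiv.Perm (Fin n)) : headSum k (v ∘ σ) ≤ headSum k v := by
  have h : Monovary (fun j : Fin n => if j.val < k then (1 : ℝ) else 0) v := by
    intro i j hij
    have hji : j < i := by
      by_contra hcon
      exact absurd (hv (not_lt.1 hcon)) (not_le.2 hij)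
    dsimp only
    split_ifs <;> first | linarith | omega
  have := h.sum_mul_comp_perm_le_sum_mul (σ := σ)
  simpa [headSum, Finset.sum_filter] using this

lemma headSum_comp_perm_le_topSum {n : ℕ} (k : ℕ) (v : Fin n → ℝ) (σ : Equiv.Perm (Fin n)) :
    headSum k (v ∘ σ) ≤ topSum k v := by
  have := headSum_comp_perm_le k (antitone_comp_sortDesc v) (σ.trans (sortDesc v).symm)
  rw [topSum_eq_headSum]
  convert this using 2
  ext i; simp

/-- On decreasing vectors the sum of the highest entries becomes linear. The concavity argument for
the tail of the sum rests on this. -/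
lemma topSum_of_antitone {n : ℕ} (k : ℕ) {v : Fin n → ℝ} (hv : Antitone v) :
    topSum k v = headSum k v :=
  le_antisymm ((topSum_eq_headSum k v).trans_le (headSum_comp_perm_le k hv _)) (headSum_comp_perm_le_topSum k v (Equiv.refl _))

lemma topSum_comp_perm {n : ℕ} (k : ℕ) (v : Fin n → ℝ) (σ : Equiv.Perm (Fin n)) :
    topSum k (v ∘ σ) = topSum k v := by
  apply le_antisymm
  · rw [topSum_eq_headSum]
    exact headSum_comp_perm_le_topSum k v ((sortDesc (v ∘ σ)).trans σ)
  · rw [topSum_eq_headSum k v]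
    have := headSum_comp_perm_le_topSum k (v ∘ σ) ((sortDesc v).trans σ.symm)
    rw [show (v ∘ σ) ∘ ((sortDesc v).trans σ.symm) = v ∘ sortDesc v by ext i; simp] at this
    exact this

/-- As a maximum of finitely many linear functionals, `topSum` is measurable without any statement
about how the sorting permutation depends on v. -/
lemma topSum_eq_sup' {n : ℕ} (k : ℕ) :
    (topSum k : (Fin n → ℝ) → ℝ) = Finset.univ.sup' Finset.univ_nonempty
      (fun (σ : Equiv.Perm (Fin n)) (v : Fin n → ℝ) => headSum k (v ∘ σ)) := by
  ext v
  rw [Finset.sup'_apply]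
  apply le_antisymm
  · rw [topSum_eq_headSum]
    exact Finset.le_sup' (fun σ : Equiv.Perm (Fin n) => headSum k (v ∘ σ)) (Finset.mem_univ _)
  · exact Finset.sup'_le _ _ fun σ _ => headSum_comp_perm_le_topSum k v σ

@[fun_prop]
lemma measurable_headSum {n : ℕ} (k : ℕ) : Measurable (headSum k : (Fin n → ℝ) → ℝ) := by
  unfold headSum; fun_prop

@[fun_prop]
lemma measurable_topSum {n : ℕ} (k : ℕ) : Measurable (topSum k : (Fin n → ℝ) → ℝ) := by
  rw [topSum_eq_sup']
  refine Finset.measurable_sup' _ fun σ _ => ?_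
  exact (measurable_headSum k).comp (by fun_prop)

lemma topSum_zero {n : ℕ} (v : Fin n → ℝ) : topSum 0 v = 0 := by simp [topSum]

lemma topSum_mono {n : ℕ} {j k : ℕ} (h : j ≤ k) {v : Fin n → ℝ} (hv : ∀ i, 0 ≤ v i) :
    topSum j v ≤ topSum k v := by
  refine Finset.sum_le_sum_of_subset_of_nonneg ?_ fun i _ _ => hv _
  intro i; simp only [Finset.mem_filter, Finset.mem_univ, true_and]; omega

lemma topSum_nonneg {n : ℕ} (k : ℕ) {v : Fin n → ℝ} (hv : ∀ i, 0 ≤ v i) : 0 ≤ topSum k v :=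
  Finset.sum_nonneg fun _ _ => hv _

lemma topSum_self {n : ℕ} (v : Fin n → ℝ) : topSum n v = ∑ i, v i := by
  have : headSum n (v ∘ sortDesc v) = ∑ i, (v ∘ sortDesc v) i := by simp [headSum]
  rw [topSum_eq_headSum, this]
  exact Equiv.sum_comp (sortDesc v) v

/-! ### Mechanisms -/

section
variable {F : Measure ℝ} [IsProbabilityMeasure F]

instance (n : ℕ) : IsProbabilityMeasure (valuationLaw F n) := by
  unfold valuationLaw; infer_instance

instance (n k : ℕ) : IsProbabilityMeasure (topSumLaw F n k) :=
  Measure.isProbabilityMeasure_map (measurable_topSum k).aemeasurable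

lemma ae_valuation_nonneg (hF : ∀ᵐ x ∂F, 0 ≤ x) (n : ℕ) :
    ∀ᵐ v ∂(valuationLaw F n), ∀ i, 0 ≤ v i := by
  rw [ae_all_iff]
  intro i
  exact (measurePreserving_eval (fun _ : Fin n => F) i).quasiMeasurePreserving.ae hF

lemma Mechanism.pay_le_topSum {n k : ℕ} (M : Mechanism n k) {v : Fin n → ℝ}
    (hv : ∀ i, 0 ≤ v i) (h : 0 ≤ M.utility v v) : (M.pay v : ℝ) ≤ topSum k v := by
  have hsum : ∑ j : Fin (k + 1), (M.alloc v j).toReal = 1 := by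
    rw [← ENNReal.toReal_sum (fun j _ => (M.alloc v).apply_ne_top j)]
    have := (M.alloc v).tsum_coe
    rw [tsum_fintype] at this
    simp [this]
  have : ∑ j : Fin (k + 1), (M.alloc v j).toReal * topSum j.val v ≤
      ∑ j : Fin (k + 1), (M.alloc v j).toReal * topSum k v :=
    Finset.sum_le_sum fun j _ => mul_le_mul_of_nonneg_left
      (topSum_mono (Nat.lt_succ_iff.1 j.2) hv) ENNReal.toReal_nonneg
  rw [← Finset.sum_mul, hsum, one_mul] at this
  unfold Mechanism.utility at h
  linarith

/-- The revenue is at most the expected value of all items. -/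
lemma optRevenue_le_lintegral (hF : ∀ᵐ x ∂F, 0 ≤ x) (n k : ℕ) :
    optRevenue F n k ≤ ∫⁻ v, ENNReal.ofReal (topSum k v) ∂(valuationLaw F n) := by
  refine iSup₂_le fun M hM => lintegral_mono_ae ?_
  filter_upwards [ae_valuation_nonneg hF n, hM.ir] with v hv h
  rw [← ENNReal.ofReal_coe_nnreal]
  exact ENNReal.ofReal_le_ofReal (M.pay_le_topSum hv h)

lemma utility_bundleMechanism {n k : ℕ} (P : ℝ≥0) (v w : Fin n → ℝ) :
    (bundleMechanism n k P).utility v w = if (P : ℝ) ≤ topSum k w then topSum k v - P else 0 := by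
  unfold Mechanism.utility bundleMechanism
  split_ifs with h
  · simp [PMF.pure_apply, h, apply_ite ENNReal.toReal]
  · simp [PMF.pure_apply, h, apply_ite ENNReal.toReal, topSum_zero]

lemma measurableSet_le_topSum (n k : ℕ) (P : ℝ) :
    MeasurableSet {v : Fin n → ℝ | P ≤ topSum k v} :=
  measurableSet_le measurable_const (measurable_topSum k)

lemma isBIC_bundleMechanism (F : Measure ℝ) (n k : ℕ) (P : ℝ≥0) :
    (bundleMechanism n k P).IsBIC F where
  measurable_alloc j := by
    have : (fun v => (bundleMechanism n k P).alloc v j) = fun v =>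
        if (P : ℝ) ≤ topSum k v then PMF.pure (Fin.last k) j else PMF.pure 0 j := by
      ext v; simp only [bundleMechanism]; split_ifs <;> rfl
    rw [this]
    exact Measurable.ite (measurableSet_le_topSum n k P) measurable_const measurable_const
  measurable_pay := Measurable.ite (measurableSet_le_topSum n k P) measurable_const
    measurable_const
  ic := ae_of_all _ fun v w _ => by
    rw [utility_bundleMechanism, utility_bundleMechanism]
    split_ifs <;> linarith
  ir := ae_of_all _ fun v => by
    rw [utility_bundleMechanism]
    split_ifs <;> linarith

lemma revenue_bundleMechanism (F : Measure ℝ) (n k : ℕ) (P : ℝ≥0) :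
    (bundleMechanism n k P).revenue F =
      P * valuationLaw F n {v | (P : ℝ) ≤ topSum k v} := by
  have : ∀ v : Fin n → ℝ, ((bundleMechanism n k P).pay v : ℝ≥0∞) =
      {v | (P : ℝ) ≤ topSum k v}.indicator (fun _ => (P : ℝ≥0∞)) v := by
    intro v
    simp only [bundleMechanism, Set.indicator, Set.mem_ofPred_eq]
    split_ifs <;> simp
  unfold Mechanism.revenue
  simp_rw [this]
  rw [lintegral_indicator_const (measurableSet_le_topSum n k P)]

lemma revenue_le_optRevenue (F : Measure ℝ) (n k : ℕ) (P : ℝ≥0) :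
    (bundleMechanism n k P).revenue F ≤ optRevenue F n k :=
  le_iSup₂_of_le (bundleMechanism n k P) (isBIC_bundleMechanism F n k P) le_rfl

end

/-! ### Selling all items: the law of large numbers -/

section
variable {F : Measure ℝ} [IsProbabilityMeasure F]

/-- The weak law of large numbers for the joint law of the valuations. -/
lemma tendsto_valuationLaw_sum_ge (hint : Integrable (fun x : ℝ => x) F) {ε : ℝ} (hε : 0 < ε) :
    Tendsto (fun n : ℕ => (valuationLaw F n).real {v | (n : ℝ) * ((∫ x, x ∂F) - ε) ≤ ∑ i, v i})
      atTop (𝓝 1) := by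
  set m := ∫ x, x ∂F
  -- The valuations for all n are realized as initial segments of one i.i.d. sequence, so that the
  -- strong law applies.
  let μ : Measure (ℕ → ℝ) := Measure.infinitePi fun _ => F
  let X : ℕ → (ℕ → ℝ) → ℝ := fun i ω => ω i
  have hX : ∀ i, Measurable (X i) := fun i => measurable_pi_apply i
  have hindep : iIndepFun X μ := iIndepFun_infinitePi (X := fun _ x => x) fun _ => measurable_id
  have hmap : ∀ i, μ.map (X i) = F := fun i => Measure.infinitePi_map_eval _ i
  have hmean : ∫ ω, X 0 ω ∂μ = m := by
    have := integral_map (μ := μ) (hX 0).aemeasurable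
      (f := fun x : ℝ => x) measurable_id.aestronglyMeasurable
    rw [hmap 0] at this
    exact this.symm
  have hslln := strong_law_ae_real (μ := μ) X
    (by
      have := (integrable_map_measure (μ := μ) (f := X 0) (g := fun x : ℝ => x)
        measurable_id.aestronglyMeasurable (hX 0).aemeasurable)
      rw [hmap 0] at this
      exact this.1 hint)
    (fun i j hij => hindep.indepFun hij)
    (fun i => ⟨(hX i).aemeasurable, (hX 0).aemeasurable, by rw [hmap, hmap]⟩)
  rw [hmean] at hslln
  -- Only convergence in probability is needed, and it depends on the law of the first n coordinates
  -- alone.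
  have hmeas := tendstoInMeasure_of_tendsto_ae
    (f := fun (n : ℕ) ω => (∑ i ∈ Finset.range n, X i ω) / n) (g := fun _ => m)
    (fun n => (by fun_prop : Measurable _).aestronglyMeasurable) hslln
  rw [tendstoInMeasure_iff_dist] at hmeas
  have h0 := hmeas ε hε
  have hlaw : ∀ n : ℕ, (valuationLaw F n) = μ.map (fun ω (i : Fin n) => ω i) := by
    intro n
    have := iIndepFun.map_fun_eq_pi_map (f := fun i : Fin n => X i)
      (fun i => (hX i).aemeasurable) (hindep.precomp Fin.val_injective)
    simp_rw [hmap] at this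
    exact this.symm
  have h1 : Tendsto (fun n : ℕ => 1 - μ.real {ω | ε ≤ dist ((∑ i ∈ Finset.range n, X i ω) / n) m})
      atTop (𝓝 (1 - 0)) :=
    tendsto_const_nhds.sub ((ENNReal.tendsto_toReal ENNReal.zero_ne_top).comp h0)
  rw [sub_zero] at h1
  refine tendsto_of_tendsto_of_tendsto_of_le_of_le' h1 tendsto_const_nhds ?_
    (Eventually.of_forall fun n => measureReal_le_one)
  filter_upwards [eventually_gt_atTop 0] with n hn
  have hms : MeasurableSet {v : Fin n → ℝ | (n : ℝ) * (m - ε) ≤ ∑ i, v i} :=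
    measurableSet_le measurable_const (by fun_prop)
  have hms' : MeasurableSet {ω | ε ≤ dist ((∑ i ∈ Finset.range n, X i ω) / n) m} :=
    measurableSet_le measurable_const (by fun_prop)
  rw [hlaw, map_measureReal_apply (by fun_prop) hms, ← probReal_compl_eq_one_sub hms']
  refine measureReal_mono fun ω hω => ?_
  have hn' : (0 : ℝ) < n := by exact_mod_cast hn
  simp only [Set.mem_compl_iff, Set.mem_ofPred_eq, not_le, Real.dist_eq, abs_lt] at hω
  have h2 := hω.1
  rw [Set.mem_preimage, Set.mem_ofPred_eq, Fin.sum_univ_eq_sum_range (fun i => ω i) n]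
  have h3 : m - ε < (∑ i ∈ Finset.range n, X i ω) / n := by linarith
  rw [lt_div_iff₀ hn'] at h3
  have : ∑ i ∈ Finset.range n, X i ω = ∑ i ∈ Finset.range n, ω i := rfl
  linarith

lemma optRevenue_self_le (hF : ∀ᵐ x ∂F, 0 ≤ x) (hint : Integrable (fun x : ℝ => x) F) (n : ℕ) :
    optRevenue F n n ≤ ENNReal.ofReal (n * ∫ x, x ∂F) := by
  refine (optRevenue_le_lintegral hF n n).trans ?_
  have hi : ∀ i, Integrable (fun v : Fin n → ℝ => v i) (valuationLaw F n) := fun i =>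
    (measurePreserving_eval (fun _ : Fin n => F) i).integrable_comp_of_integrable hint
  simp_rw [topSum_self]
  rw [← ofReal_integral_eq_lintegral_ofReal (integrable_finsetSum _ fun i _ => hi i)]
  · refine ENNReal.ofReal_le_ofReal (le_of_eq ?_)
    rw [integral_finsetSum _ fun i _ => hi i]
    have : ∀ i : Fin n, ∫ v, v i ∂(valuationLaw F n) = ∫ x, x ∂F := fun i =>
      integral_comp_eval (μ := fun _ : Fin n => F) (i := i) (f := fun x : ℝ => x)
        measurable_id.aestronglyMeasurable
    simp [this]
  · filter_upwards [ae_valuation_nonneg hF n] with v hv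
    exact Finset.sum_nonneg fun i _ => hv i

lemma toReal_revenue_bundleMechanism_self (F : Measure ℝ) (n : ℕ) {P : ℝ} (hP : 0 ≤ P) :
    ((bundleMechanism n n (n * P).toNNReal).revenue F).toReal =
      n * (P * (valuationLaw F n).real {v | n * P ≤ ∑ i, v i}) := by
  rw [revenue_bundleMechanism, ENNReal.toReal_mul, ENNReal.coe_toReal,
    Real.coe_toNNReal _ (by positivity), mul_assoc]
  simp_rw [topSum_self]
  rfl

lemma tendsto_toReal_revenue_div (hint : Integrable (fun x : ℝ => x) F) {ε : ℝ} (hε : 0 < ε)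
    (hεm : ε < ∫ x, x ∂F) :
    Tendsto (fun n : ℕ => ((bundleMechanism n n
      ((n : ℝ) * ((∫ x, x ∂F) - ε)).toNNReal).revenue F).toReal / n) atTop
      (𝓝 ((∫ x, x ∂F) - ε)) := by
  have := (tendsto_valuationLaw_sum_ge hint hε).const_mul ((∫ x, x ∂F) - ε)
  rw [mul_one] at this
  refine this.congr' ?_
  filter_upwards [eventually_gt_atTop 0] with n hn
  have hn' : (n : ℝ) ≠ 0 := by exact_mod_cast hn.ne'
  rw [toReal_revenue_bundleMechanism_self F n (sub_nonneg.2 hεm.le), mul_div_cancel_left₀ _ hn']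

/-- The upper bound is the mean value of all items. The lower bound is the bundle itself, with ε
small enough that its limit m - ε still exceeds a given a < m. -/
lemma tendsto_toReal_optRevenue_div (hF : ∀ᵐ x ∂F, 0 ≤ x)
    (hint : Integrable (fun x : ℝ => x) F) (hm : 0 < ∫ x, x ∂F) :
    Tendsto (fun n : ℕ => (optRevenue F n n).toReal / n) atTop (𝓝 (∫ x, x ∂F)) := by
  rw [tendsto_order]
  constructor
  · intro a ha
    set m := ∫ x, x ∂F
    obtain ⟨ε, hε, hε'⟩ := exists_between (lt_min hm (sub_pos.2 ha))
    have h1 := hε'.trans_le (min_le_left _ _)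
    have h2 := hε'.trans_le (min_le_right _ _)
    have h3 : a < m - ε := by linarith
    filter_upwards [(tendsto_toReal_revenue_div hint hε h1).eventually_const_lt h3] with n hn
    refine hn.trans_le ?_
    gcongr
    · exact ((optRevenue_self_le hF hint n).trans_lt ENNReal.ofReal_lt_top).ne
    · exact revenue_le_optRevenue F _ _ _
  · intro a ha
    refine Eventually.of_forall fun n => lt_of_le_of_lt ?_ ha
    refine div_le_of_le_mul₀ n.cast_nonneg hm.le ?_
    refine (ENNReal.toReal_mono ENNReal.ofReal_ne_top (optRevenue_self_le hF hint n)).trans ?_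
    rw [ENNReal.toReal_ofReal (by positivity), mul_comm]

lemma tendsto_revenue_div_optRevenue (hF : ∀ᵐ x ∂F, 0 ≤ x)
    (hint : Integrable (fun x : ℝ => x) F) (hm : 0 < ∫ x, x ∂F) {ε : ℝ} (hε : 0 < ε)
    (hεm : ε < ∫ x, x ∂F) :
    Tendsto (fun n : ℕ => (bundleMechanism n n ((n : ℝ) * ((∫ x, x ∂F) - ε)).toNNReal).revenue F /
      optRevenue F n n) atTop (𝓝 (ENNReal.ofReal (1 - ε / ∫ x, x ∂F))) := by
  have hopt := tendsto_toReal_optRevenue_div hF hint hm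
  have h := (tendsto_toReal_revenue_div hint hε hεm).div hopt hm.ne'
  rw [sub_div, div_self hm.ne'] at h
  refine (ENNReal.tendsto_ofReal h).congr' ?_
  -- The quotient in `ℝ≥0∞` agrees with the real one once the optimal revenue is finite and
  -- positive. Positivity holds for large n because the revenue per buyer tends to the positive
  -- mean.
  filter_upwards [eventually_gt_atTop 0, hopt.eventually_const_lt hm] with n hn hpos
  have hn' : (0 : ℝ) < n := by exact_mod_cast hn
  have hfin : optRevenue F n n ≠ ⊤ :=
    ((optRevenue_self_le hF hint n).trans_lt ENNReal.ofReal_lt_top).ne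
  have hpos' : 0 < (optRevenue F n n).toReal := (div_pos_iff_of_pos_right hn').1 hpos
  rw [Pi.div_apply, div_div_div_cancel_right₀ hn'.ne', ENNReal.ofReal_div_of_pos hpos',
    ENNReal.ofReal_toReal hfin, ENNReal.ofReal_toReal]
  exact ((revenue_le_optRevenue F _ _ _).trans_lt hfin.lt_top).ne

lemma eventually_le_revenue (hF : ∀ᵐ x ∂F, 0 ≤ x)
    (hint : Integrable (fun x : ℝ => x) F) (hm : 0 < ∫ x, x ∂F) {δ : ℝ} (hδ : 0 < δ) :
    ∃ ε₀ : ℝ, 0 < ε₀ ∧ ∀ ε : ℝ, 0 < ε → ε < ε₀ → ∀ᶠ n : ℕ in atTop,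
      ENNReal.ofReal (1 - δ) * optRevenue F n n ≤
        (bundleMechanism n n ((n : ℝ) * ((∫ x, x ∂F) - ε)).toNNReal).revenue F := by
  set m := ∫ x, x ∂F with hm_def
  -- The bound δ·m gives 1 - δ < 1 - ε/m. The bound m makes 1 - ε/m positive, so the inequality
  -- stays strict under `ENNReal.ofReal` even when δ ≥ 1.
  refine ⟨min m (δ * m), by positivity, fun ε hε hε' => ?_⟩
  have h1 := hε'.trans_le (min_le_left _ _)
  have h2 := hε'.trans_le (min_le_right _ _)
  have h3 : ε / m < δ := (div_lt_iff₀ hm).2 h2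
  have h4 : ε / m < 1 := (div_lt_one hm).2 h1
  have hlt : ENNReal.ofReal (1 - δ) < ENNReal.ofReal (1 - ε / m) :=
    (ENNReal.ofReal_lt_ofReal_iff (by linarith)).2 (by linarith)
  filter_upwards [(tendsto_revenue_div_optRevenue hF hint hm hε h1).eventually_const_lt hlt]
    with n hn
  exact ENNReal.mul_le_of_le_div hn.le

end

/-! ### Log-concave functions and their marginals -/

/-- A nonnegative function that is log-concave. -/
structure IsLogConcave {E : Type*} [AddCommGroup E] [Module ℝ E] (φ : E → ℝ) : Prop where
  nonneg : ∀ x, 0 ≤ φ x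
  rpow_mul_le : ∀ (x y : E) (a b : ℝ), 0 < a → 0 < b → a + b = 1 →
    φ x ^ a * φ y ^ b ≤ φ (a • x + b • y)

/-- The Brunn-Minkowski inequality for intervals. -/
lemma volume_convexCombo_le {A B C : Set ℝ} (hA : A.OrdConnected) (hB : B.OrdConnected)
    (hA' : A.Nonempty) (hB' : B.Nonempty) {a b : ℝ} (ha : 0 < a) (hb : 0 < b)
    (h : ∀ x ∈ A, ∀ y ∈ B, a * x + b * y ∈ C) :
    ENNReal.ofReal a * volume A + ENNReal.ofReal b * volume B ≤ volume C := by
  rcases eq_or_ne (volume C) ⊤ with hC | hC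
  · rw [hC]; exact le_top
  -- Moving from x to x' and from y to y' at the same parameter stays in A and B, and the
  -- combinations sweep out an interval inside C.
  have key : ∀ x ∈ A, ∀ x' ∈ A, ∀ y ∈ B, ∀ y' ∈ B, x ≤ x' → y ≤ y' →
      a * (x' - x) + b * (y' - y) ≤ (volume C).toReal := by
    intro x hx x' hx' y hy y' hy' hxx hyy
    have hsub : Set.Icc (a * x + b * y) (a * x' + b * y') ⊆ C := by
      have hcont : ContinuousOn (fun t : ℝ => a * (x + t * (x' - x)) + b * (y + t * (y' - y)))
          (Set.Icc 0 1) := by fun_prop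
      intro z hz
      have := intermediate_value_Icc zero_le_one hcont
      have hz' : z ∈ Set.Icc (a * (x + 0 * (x' - x)) + b * (y + 0 * (y' - y)))
          (a * (x + 1 * (x' - x)) + b * (y + 1 * (y' - y))) := by
        convert hz using 2 <;> ring
      obtain ⟨t, ht, rfl⟩ := this hz'
      refine h _ (hA.out hx hx' ⟨?_, ?_⟩) _ (hB.out hy hy' ⟨?_, ?_⟩) <;>
        nlinarith [ht.1, ht.2]
    have := measure_mono (μ := volume) hsub
    rw [Real.volume_Icc] at this
    have := (ENNReal.ofReal_le_iff_le_toReal hC).1 this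
    linarith
  have key2 : ∀ x ∈ A, ∀ x' ∈ A, ∀ y ∈ B, ∀ y' ∈ B,
      a * dist x x' + b * dist y y' ≤ (volume C).toReal := by
    intro x hx x' hx' y hy y' hy'
    rcases le_total x x' with h1 | h1 <;> rcases le_total y y' with h2 | h2
    · have := key x hx x' hx' y hy y' hy' h1 h2
      rw [Real.dist_eq, Real.dist_eq, abs_of_nonpos (by linarith), abs_of_nonpos (by linarith)]
      linarith
    · have := key x hx x' hx' y' hy' y hy h1 h2
      rw [Real.dist_eq, Real.dist_eq, abs_of_nonpos (by linarith), abs_of_nonneg (by linarith)]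
      linarith
    · have := key x' hx' x hx y hy y' hy' h1 h2
      rw [Real.dist_eq, Real.dist_eq, abs_of_nonneg (by linarith), abs_of_nonpos (by linarith)]
      linarith
    · have := key x' hx' x hx y' hy' y hy h1 h2
      rw [Real.dist_eq, Real.dist_eq, abs_of_nonneg (by linarith), abs_of_nonneg (by linarith)]
      linarith
  set V := (volume C).toReal
  -- Volume on the line is at most the diameter. Taking suprema over pairs in B, then over pairs in
  -- A, turns the bound on distances into one on volumes, with no measurability of the sets.
  have hbB : ∀ x ∈ A, ∀ x' ∈ A, volume B ≤ ENNReal.ofReal ((V - a * dist x x') / b) := by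
    intro x hx x' hx'
    refine (Real.volume_le_diam B).trans (Metric.ediam_le fun y hy y' hy' => ?_)
    rw [edist_dist]
    refine ENNReal.ofReal_le_ofReal ?_
    rw [le_div_iff₀ hb]
    linarith [key2 x hx x' hx' y hy y' hy']
  have hBfin : volume B ≠ ⊤ := by
    obtain ⟨x, hx⟩ := hA'
    exact ((hbB x hx x hx).trans_lt ENNReal.ofReal_lt_top).ne
  have hbB' : ∀ x ∈ A, ∀ x' ∈ A, dist x x' ≤ (V - b * (volume B).toReal) / a := by
    intro x hx x' hx'
    obtain ⟨y, hy⟩ := hB'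
    have h0 : 0 ≤ (V - a * dist x x') / b := by
      have := key2 x hx x' hx' y hy y hy
      rw [dist_self] at this
      exact div_nonneg (by linarith) hb.le
    have := ENNReal.toReal_mono ENNReal.ofReal_ne_top (hbB x hx x' hx')
    rw [ENNReal.toReal_ofReal h0, le_div_iff₀ hb] at this
    rw [le_div_iff₀ ha]
    linarith
  have hA'' : volume A ≤ ENNReal.ofReal ((V - b * (volume B).toReal) / a) := by
    refine (Real.volume_le_diam A).trans (Metric.ediam_le fun x hx x' hx' => ?_)
    rw [edist_dist]
    exact ENNReal.ofReal_le_ofReal (hbB' x hx x' hx')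
  have h0 : 0 ≤ (V - b * (volume B).toReal) / a := by
    obtain ⟨x, hx⟩ := hA'
    exact dist_nonneg.trans (hbB' x hx x hx)
  have h0' : 0 ≤ V - b * (volume B).toReal := by
    have := mul_nonneg h0 ha.le
    rwa [div_mul_cancel₀ _ ha.ne'] at this
  calc ENNReal.ofReal a * volume A + ENNReal.ofReal b * volume B
      ≤ ENNReal.ofReal a * ENNReal.ofReal ((V - b * (volume B).toReal) / a) +
        ENNReal.ofReal b * ENNReal.ofReal (volume B).toReal := by
          gcongr
          rw [ENNReal.ofReal_toReal hBfin]
    _ = ENNReal.ofReal V := by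
          rw [← ENNReal.ofReal_mul ha.le, ← ENNReal.ofReal_mul hb.le,
            mul_div_cancel₀ _ ha.ne', ← ENNReal.ofReal_add h0' (by positivity)]
          congr 1; ring
    _ = volume C := ENNReal.ofReal_toReal hC

/-- The Prékopa-Leindler inequality for unimodal functions with supremum one, in its additive
form. -/
lemma integral_add_integral_le_of_sup_one {f g h : ℝ → ℝ} {a b : ℝ} (ha : 0 < a) (hb : 0 < b)
    (hab : a + b = 1)
    (hf : Integrable f) (hg : Integrable g) (hh : Integrable h)
    (hf0 : ∀ x, 0 ≤ f x) (hg0 : ∀ x, 0 ≤ g x) (hh0 : ∀ x, 0 ≤ h x)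
    (hf1 : ∀ x, f x ≤ 1) (hg1 : ∀ x, g x ≤ 1)
    (hfs : ∀ t < 1, ∃ x, t < f x) (hgs : ∀ t < 1, ∃ x, t < g x)
    (hfc : ∀ t, {x | t < f x}.OrdConnected) (hgc : ∀ t, {x | t < g x}.OrdConnected)
    (hfgh : ∀ x y, f x ^ a * g y ^ b ≤ h (a * x + b * y)) :
    a * (∫ x, f x) + b * (∫ x, g x) ≤ ∫ x, h x := by
  -- Brunn-Minkowski is applied to superlevel sets and then integrated over t by the layer-cake
  -- formula. Supremum one for both functions makes both sets nonempty for t < 1 and both empty for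
  -- t ≥ 1.
  have hlev : ∀ t ∈ Set.Ioi (0 : ℝ), ENNReal.ofReal a * volume {x | t < f x} +
      ENNReal.ofReal b * volume {x | t < g x} ≤ volume {x | t < h x} := by
    intro t ht
    rcases lt_or_ge t 1 with ht1 | ht1
    · refine volume_convexCombo_le (hfc t) (hgc t) (hfs t ht1) (hgs t ht1) ha hb ?_
      intro x hx y hy
      refine lt_of_lt_of_le ?_ (hfgh x y)
      calc t = t ^ a * t ^ b := by rw [← Real.rpow_add ht, hab, Real.rpow_one]
        _ < f x ^ a * g y ^ b := by
          have h1 := Real.rpow_lt_rpow (le_of_lt ht) hx ha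
          have h2 := Real.rpow_lt_rpow (le_of_lt ht) hy hb
          have h3 := Real.rpow_pos_of_pos ht a
          have h4 := Real.rpow_pos_of_pos ht b
          exact mul_lt_mul'' h1 h2 h3.le h4.le
    · have e1 : {x | t < f x} = ∅ := by
        ext x; simpa using (hf1 x).trans ht1
      have e2 : {x | t < g x} = ∅ := by
        ext x; simpa using (hg1 x).trans ht1
      simp [e1, e2]
  have hmeas : ∀ u : ℝ → ℝ, Measurable fun t => volume {x | t < u x} := fun u =>
    Antitone.measurable fun s t hst => measure_mono fun x (hx : t < u x) => hst.trans_lt hx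
  have := setLIntegral_mono (μ := volume) (hmeas h) hlev
  rw [lintegral_add_left ((hmeas f).const_mul _), lintegral_const_mul _ (hmeas f),
    lintegral_const_mul _ (hmeas g),
    ← lintegral_eq_lintegral_meas_lt volume (ae_of_all _ hf0) hf.aemeasurable,
    ← lintegral_eq_lintegral_meas_lt volume (ae_of_all _ hg0) hg.aemeasurable,
    ← lintegral_eq_lintegral_meas_lt volume (ae_of_all _ hh0) hh.aemeasurable,
    ← ofReal_integral_eq_lintegral_ofReal hf (ae_of_all _ hf0),
    ← ofReal_integral_eq_lintegral_ofReal hg (ae_of_all _ hg0),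
    ← ofReal_integral_eq_lintegral_ofReal hh (ae_of_all _ hh0),
    ← ENNReal.ofReal_mul ha.le, ← ENNReal.ofReal_mul hb.le,
    ← ENNReal.ofReal_add (mul_nonneg ha.le (integral_nonneg hf0))
      (mul_nonneg hb.le (integral_nonneg hg0)),
    ENNReal.ofReal_le_ofReal_iff (integral_nonneg hh0)] at this
  exact this

/-- The Prékopa-Leindler inequality for bounded unimodal functions on the line. -/
lemma rpow_integral_mul_rpow_integral_le {f g h : ℝ → ℝ} {a b : ℝ} (ha : 0 < a) (hb : 0 < b)
    (hab : a + b = 1)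
    (hf : Integrable f) (hg : Integrable g) (hh : Integrable h)
    (hf0 : ∀ x, 0 ≤ f x) (hg0 : ∀ x, 0 ≤ g x) (hh0 : ∀ x, 0 ≤ h x)
    (hf1 : ∀ x, f x ≤ 1) (hg1 : ∀ x, g x ≤ 1)
    (hfc : ∀ t, {x | t < f x}.OrdConnected) (hgc : ∀ t, {x | t < g x}.OrdConnected)
    (hfgh : ∀ x y, f x ^ a * g y ^ b ≤ h (a * x + b * y)) :
    (∫ x, f x) ^ a * (∫ x, g x) ^ b ≤ ∫ x, h x := by
  by_cases hfz : ∀ x, f x = 0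
  · simp only [hfz, integral_zero, Real.zero_rpow ha.ne', zero_mul]
    exact integral_nonneg hh0
  by_cases hgz : ∀ x, g x = 0
  · simp only [hgz, integral_zero, Real.zero_rpow hb.ne', mul_zero]
    exact integral_nonneg hh0
  -- Dividing f and g by their suprema M and N, and h by M^a·N^b, reduces to supremum one while
  -- preserving the hypothesis.
  have hsup : ∀ u : ℝ → ℝ, (∀ x, 0 ≤ u x) → (∀ x, u x ≤ 1) → (¬ ∀ x, u x = 0) →
      0 < ⨆ x, u x ∧ (∀ x, u x / (⨆ x, u x) ≤ 1) ∧ ∀ t < 1, ∃ x, t < u x / ⨆ x, u x := by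
    intro u hu0 hu1 huz
    push Not at huz
    obtain ⟨x, hx⟩ := huz
    have hbdd : BddAbove (Set.range u) := ⟨1, by rintro _ ⟨y, rfl⟩; exact hu1 y⟩
    have hpos : 0 < ⨆ x, u x := ((hu0 x).lt_of_ne' hx).trans_le (le_ciSup hbdd x)
    refine ⟨hpos, fun y => (div_le_one hpos).2 (le_ciSup hbdd y), fun t ht => ?_⟩
    have : t * (⨆ x, u x) < ⨆ x, u x := by nlinarith
    obtain ⟨y, hy⟩ := exists_lt_of_lt_ciSup this
    exact ⟨y, (lt_div_iff₀ hpos).2 hy⟩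
  obtain ⟨hM, hfM, hfs⟩ := hsup f hf0 hf1 hfz
  obtain ⟨hN, hgN, hgs⟩ := hsup g hg0 hg1 hgz
  set M := ⨆ x, f x
  set N := ⨆ x, g x
  have hK : 0 < M ^ a * N ^ b := mul_pos (Real.rpow_pos_of_pos hM a) (Real.rpow_pos_of_pos hN b)
  have main := integral_add_integral_le_of_sup_one (f := fun x => f x / M) (g := fun x => g x / N)
    (h := fun x => h x / (M ^ a * N ^ b)) ha hb hab (hf.div_const _) (hg.div_const _)
    (hh.div_const _) (fun x => div_nonneg (hf0 x) hM.le) (fun x => div_nonneg (hg0 x) hN.le)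
    (fun x => div_nonneg (hh0 x) hK.le) hfM hgN hfs hgs
    (fun t => by simpa only [lt_div_iff₀ hM] using hfc (t * M))
    (fun t => by simpa only [lt_div_iff₀ hN] using hgc (t * N))
    (fun x y => by
      rw [Real.div_rpow (hf0 x) hM.le, Real.div_rpow (hg0 y) hN.le, div_mul_div_comm]
      exact div_le_div_of_nonneg_right (hfgh x y) hK.le)
  simp only [integral_div] at main
  have hf' : 0 ≤ ∫ x, f x := integral_nonneg hf0
  have hg' : 0 ≤ ∫ x, g x := integral_nonneg hg0
  -- The weighted AM-GM inequality passes from the additive form to the multiplicative one, in which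
  -- the normalizing factors cancel.
  have amgm := (Real.geom_mean_le_arith_mean2_weighted ha.le hb.le (div_nonneg hf' hM.le)
    (div_nonneg hg' hN.le) hab).trans main
  rw [Real.div_rpow hf' hM.le, Real.div_rpow hg' hN.le, div_mul_div_comm,
    div_le_div_iff_of_pos_right hK] at amgm
  exact amgm

lemma IsLogConcave.ordConnected {u : ℝ → ℝ} (hu : IsLogConcave u) (t : ℝ) :
    {x | t < u x}.OrdConnected := by
  rcases lt_or_ge t 0 with ht | ht
  · have : {x | t < u x} = Set.univ := by
      ext x; simpa using ht.trans_le (hu.nonneg x)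
    rw [this]; exact Set.ordConnected_univ
  refine Convex.ordConnected (convex_iff_forall_pos.2 fun x hx y hy a b ha hb hab => ?_)
  refine lt_of_lt_of_le ?_ (hu.rpow_mul_le x y a b ha hb hab)
  calc t = t ^ a * t ^ b := by
        rcases ht.eq_or_lt with rfl | ht
        · rw [Real.zero_rpow ha.ne', zero_mul]
        · rw [← Real.rpow_add ht, hab, Real.rpow_one]
    _ < u x ^ a * u y ^ b := mul_lt_mul'' (Real.rpow_lt_rpow ht hx ha)
        (Real.rpow_lt_rpow ht hy hb) (Real.rpow_nonneg ht a) (Real.rpow_nonneg ht b)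

/-- Marginals of log-concave functions with respect to a product of log-concave probability
densities are log-concave. -/
theorem IsLogConcave.integral_pi {E : Type*} [AddCommGroup E] [Module ℝ E] {w : ℝ → ℝ}
    (hw : IsLogConcave w) (hwm : Measurable w) (hw1 : ∀ x, w x ≤ 1) (hwi : Integrable w)
    [IsProbabilityMeasure (volume.withDensity fun x => ENNReal.ofReal (w x))] (n : ℕ)
    {φ : E × (Fin n → ℝ) → ℝ} (hφ : IsLogConcave φ) (hφ1 : ∀ p, φ p ≤ 1)
    (hφm : ∀ x, Measurable fun v => φ (x, v)) :
    IsLogConcave fun x => ∫ v, φ (x, v) ∂(Measure.pi fun _ : Fin n =>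
      volume.withDensity fun x => ENNReal.ofReal (w x)) := by
  set μ := volume.withDensity fun x => ENNReal.ofReal (w x) with hμ
  have hbound : ∀ p, ‖φ p‖ ≤ 1 := fun p => by
    rw [Real.norm_of_nonneg (hφ.nonneg p)]; exact hφ1 p
  have hint : ∀ u : ℝ → ℝ, ∫ z, u z ∂μ = ∫ z, w z * u z := by
    intro u
    rw [hμ, integral_withDensity_eq_integral_toReal_smul (by fun_prop)
      (ae_of_all _ fun x => ENNReal.ofReal_lt_top)]
    simp [ENNReal.toReal_ofReal (hw.nonneg _)]
  induction n with
  | zero =>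
    have : ∀ x, ∫ v, φ (x, v) ∂(Measure.pi fun _ : Fin 0 => μ) = φ (x, 0) := by
      intro x
      rw [Measure.pi_of_empty _ (0 : Fin 0 → ℝ), integral_dirac]
    simp_rw [this]
    refine ⟨fun x => hφ.nonneg _, fun x y a b ha hb hab => ?_⟩
    have := hφ.rpow_mul_le (x, 0) (y, 0) a b ha hb hab
    simpa using this
  | succ n ih =>
    -- One coordinate is integrated out. The one-dimensional inequality makes ψ log-concave jointly
    -- in the parameter and the remaining coordinates, so the induction hypothesis applies to it.
    let ψ : E × (Fin n → ℝ) → ℝ := fun p => ∫ z, φ (p.1, Fin.cons z p.2) ∂μ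
    have hcons : Measurable fun p : ℝ × (Fin n → ℝ) => (Fin.cons p.1 p.2 : Fin (n + 1) → ℝ) := by
      refine measurable_pi_iff.2 fun i => ?_
      refine Fin.cases ?_ (fun j => ?_) i
      · exact measurable_fst
      · exact (measurable_pi_apply j).comp measurable_snd
    have hm : ∀ x, Measurable fun p : ℝ × (Fin n → ℝ) => φ (x, Fin.cons p.1 p.2) := fun x =>
      (hφm x).comp hcons
    have hpush : ∀ x, ∫ v, φ (x, v) ∂(Measure.pi fun _ : Fin (n + 1) => μ) =
        ∫ v, ψ (x, v) ∂(Measure.pi fun _ : Fin n => μ) := by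
      intro x
      have h1 := (measurePreserving_piFinSuccAbove (fun _ : Fin (n + 1) => μ) 0).symm
      have h2 := h1.integral_comp' (fun v => φ (x, v))
      rw [← h2]
      have h3 : ∀ p : ℝ × (Fin n → ℝ),
          (MeasurableEquiv.piFinSuccAbove (fun _ : Fin (n + 1) => ℝ) 0).symm p =
            Fin.cons p.1 p.2 := by
        intro p
        simp [MeasurableEquiv.piFinSuccAbove, Fin.insertNthEquiv]
      simp_rw [h3]
      rw [integral_prod_symm]
      exact Integrable.of_bound (hm x).aestronglyMeasurable 1 (ae_of_all _ fun p => hbound _)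
    simp_rw [hpush]
    refine ih ⟨fun p => integral_nonneg fun z => hφ.nonneg _, ?_⟩ ?_ ?_ ?_
    · rintro ⟨x, u⟩ ⟨y, v⟩ a b ha hb hab
      -- Log-concave slices have interval superlevel sets, the unimodality that the one-dimensional
      -- inequality asks for.
      have hslice : ∀ x (u : Fin n → ℝ), IsLogConcave fun z => w z * φ (x, Fin.cons z u) := by
        intro x u
        refine ⟨fun z => mul_nonneg (hw.nonneg z) (hφ.nonneg _), fun s t a b ha hb hab => ?_⟩
        have e : (a • s + b • t : ℝ) = a • s + b • t := rfl
        have h1 := hw.rpow_mul_le s t a b ha hb hab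
        have h2 := hφ.rpow_mul_le (x, Fin.cons s u) (x, Fin.cons t u) a b ha hb hab
        have e2 : a • ((x, Fin.cons s u) : E × (Fin (n + 1) → ℝ)) + b • (x, Fin.cons t u) =
            (x, Fin.cons (a • s + b • t) u) := by
          ext i
          · simp [← add_smul, hab]
          · refine Fin.cases ?_ (fun j => ?_) i
            · simp
            · simp [← add_mul, hab]
        rw [e2] at h2
        rw [Real.mul_rpow (hw.nonneg _) (hφ.nonneg _), Real.mul_rpow (hw.nonneg _) (hφ.nonneg _),
          mul_mul_mul_comm]
        exact mul_le_mul h1 h2 (mul_nonneg (Real.rpow_nonneg (hφ.nonneg _) _)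
          (Real.rpow_nonneg (hφ.nonneg _) _)) (hw.nonneg _)
      have hi : ∀ x (u : Fin n → ℝ), Integrable fun z => w z * φ (x, Fin.cons z u) := by
        intro x u
        refine hwi.mul_bdd (c := 1) ?_ (ae_of_all _ fun z => hbound _)
        exact ((hm x).comp (measurable_id.prodMk measurable_const)).aestronglyMeasurable
      have h1 : ∀ x (u : Fin n → ℝ) z, w z * φ (x, Fin.cons z u) ≤ 1 := fun x u z =>
        mul_le_one₀ (hw1 z) (hφ.nonneg _) (hφ1 _)
      simp only [ψ, hint]
      refine rpow_integral_mul_rpow_integral_le ha hb hab (hi _ _) (hi _ _) (hi _ _)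
        (hslice _ _).nonneg (hslice _ _).nonneg (hslice _ _).nonneg (h1 _ _) (h1 _ _)
        (hslice _ _).ordConnected (hslice _ _).ordConnected fun s t => ?_
      have h1 := hw.rpow_mul_le s t a b ha hb hab
      have h2 := hφ.rpow_mul_le (x, Fin.cons s u) (y, Fin.cons t v) a b ha hb hab
      have e2 : a • ((x, Fin.cons s u) : E × (Fin (n + 1) → ℝ)) + b • (y, Fin.cons t v) =
          ((a • (x, u) + b • (y, v) : E × (Fin n → ℝ)).1,
            Fin.cons (a * s + b * t) (a • (x, u) + b • (y, v) : E × (Fin n → ℝ)).2) := by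
        ext i
        · simp
        · refine Fin.cases ?_ (fun j => ?_) i
          · simp
          · simp
      rw [e2] at h2
      rw [Real.mul_rpow (hw.nonneg _) (hφ.nonneg _), Real.mul_rpow (hw.nonneg _) (hφ.nonneg _),
        mul_mul_mul_comm]
      exact mul_le_mul h1 h2 (mul_nonneg (Real.rpow_nonneg (hφ.nonneg _) _)
        (Real.rpow_nonneg (hφ.nonneg _) _)) (hw.nonneg _)
    · intro p
      refine (integral_mono_of_nonneg (ae_of_all _ fun z => hφ.nonneg _) (integrable_const 1)
        (ae_of_all _ fun z => hφ1 _)).trans ?_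
      simp
    · intro x
      exact (hm x).stronglyMeasurable.integral_prod_left'.measurable
    · intro p
      rw [Real.norm_of_nonneg (integral_nonneg fun z => hφ.nonneg _)]
      refine (integral_mono_of_nonneg (ae_of_all _ fun z => hφ.nonneg _) (integrable_const 1)
        (ae_of_all _ fun z => hφ1 _)).trans ?_
      simp

/-! ### Log-concave tails -/

/-- The survival function `x ↦ μ [x, ∞)`. -/
def survival (μ : Measure ℝ) (x : ℝ) : ℝ := μ.real (Set.Ici x)

section
variable {μ : Measure ℝ}

lemma survival_nonneg (μ : Measure ℝ) (x : ℝ) : 0 ≤ survival μ x := measureReal_nonneg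

lemma antitone_survival [IsFiniteMeasure μ] : Antitone (survival μ) := fun _ _ h =>
  measureReal_mono (Set.Ici_subset_Ici.2 h)

lemma survival_le_one [IsProbabilityMeasure μ] (x : ℝ) : survival μ x ≤ 1 := measureReal_le_one

lemma survival_eq_one_sub_cdf [IsProbabilityMeasure μ] [NullSingletonClass μ] (x : ℝ) :
    survival μ x = 1 - cdf μ x := by
  rw [cdf_eq_real, ← probReal_compl_eq_one_sub measurableSet_Iic, Set.compl_Iic, survival]
  exact (measureReal_congr Ioi_ae_eq_Ici).symm

lemma survival_sub [IsFiniteMeasure μ] {x y : ℝ} (h : x ≤ y) :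
    survival μ x - survival μ y = μ.real (Set.Ico x y) := by
  have : Set.Ico x y = Set.Ici x \ Set.Ici y := by ext t; simp
  rw [this, measureReal_sdiff (Set.Ici_subset_Ici.2 h) measurableSet_Ici]
  rfl

lemma continuous_survival [IsProbabilityMeasure μ] [NullSingletonClass μ] :
    Continuous (survival μ) := by
  have hc : Continuous (cdf μ) := by
    refine continuous_iff_continuousAt.2 fun x => ?_
    rw [(monotone_cdf μ).continuousAt_iff_leftLim_eq_rightLim, (cdf μ).rightLim_eq]
    refine le_antisymm ((monotone_cdf μ).leftLim_le le_rfl) ?_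
    have := (cdf μ).measure_singleton x
    rw [measure_cdf, measure_singleton] at this
    have := ENNReal.ofReal_eq_zero.1 this.symm
    linarith
  have : survival μ = fun x => 1 - cdf μ x := funext survival_eq_one_sub_cdf
  rw [this]
  fun_prop

/-- The hypothesis is a difference form of S' ≤ -c·S, so Grönwall's inequality applies without
differentiability of S. Continuity lets S(y) be replaced by S(x) in the limit y ↓ x. -/
lemma survival_le_mul_exp_of_le [IsProbabilityMeasure μ] [NullSingletonClass μ] {c z : ℝ}
    (h : ∀ x y, z ≤ x → x < y → c * survival μ y * (y - x) ≤ survival μ x - survival μ y)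
    {u : ℝ} (hu : z ≤ u) : survival μ u ≤ survival μ z * Real.exp (-c * (u - z)) := by
  have := le_gronwallBound_of_liminf_deriv_right_le (f := survival μ)
    (f' := fun x => -c * survival μ x) (δ := survival μ z) (K := -c) (ε := 0) (a := z) (b := u)
    continuous_survival.continuousOn ?_ le_rfl (fun x _ => by simp) u ⟨hu, le_rfl⟩
  · rwa [gronwallBound_ε0] at this
  · intro x hx r hr
    refine Eventually.frequently ?_
    have hcont : Tendsto (fun y => -c * survival μ y) (𝓝[>] x) (𝓝 (-c * survival μ x)) :=
      ((continuous_survival.const_mul (-c)).tendsto x).mono_left nhdsWithin_le_nhds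
    filter_upwards [hcont.eventually_lt_const hr, self_mem_nhdsWithin] with y hy hxy
    refine lt_of_le_of_lt ?_ hy
    have hxy' : 0 < y - x := sub_pos.2 hxy
    rw [inv_mul_le_iff₀ hxy']
    have := h x y hx.1 hxy
    linarith

/-- To the left of z, Grönwall's inequality is applied to the reflection s ↦ S(z - s), which grows
at relative rate at most c. -/
lemma survival_le_mul_exp_of_ge [IsProbabilityMeasure μ] [NullSingletonClass μ] {c z : ℝ}
    (h : ∀ x y, y ≤ z → x < y → survival μ x - survival μ y ≤ c * survival μ x * (y - x))
    {u : ℝ} (hu : u ≤ z) : survival μ u ≤ survival μ z * Real.exp (-c * (u - z)) := by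
  have hcont' : Continuous fun s => survival μ (z - s) :=
    continuous_survival.comp (by fun_prop)
  have := le_gronwallBound_of_liminf_deriv_right_le (f := fun s => survival μ (z - s))
    (f' := fun s => c * survival μ (z - s)) (δ := survival μ z) (K := c) (ε := 0) (a := 0)
    (b := z - u) hcont'.continuousOn ?_ (by simp) (fun x _ => by simp) (z - u)
    ⟨by linarith, le_rfl⟩
  · rw [gronwallBound_ε0] at this
    convert this using 2
    · simp
    · congr 1; ring
  · intro s hs r hr
    refine Eventually.frequently ?_
    have hcont : Tendsto (fun y => c * survival μ (z - y)) (𝓝[>] s) (𝓝 (c * survival μ (z - s))) :=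
      ((hcont'.const_mul c).tendsto s).mono_left nhdsWithin_le_nhds
    filter_upwards [hcont.eventually_lt_const hr, self_mem_nhdsWithin] with y hy hsy
    refine lt_of_le_of_lt ?_ hy
    have hsy' : 0 < y - s := sub_pos.2 hsy
    rw [inv_mul_le_iff₀ hsy']
    have hsy2 : s < y := hsy
    have := h (z - y) (z - s) (by linarith [hs.1]) (by linarith)
    calc _ ≤ _ := this
      _ = _ := by ring

lemma IsDensity.absolutelyContinuous {f : ℝ → ℝ} (hf : IsDensity μ f) : μ ≪ volume := by
  rw [hf.eq_withDensity]; exact withDensity_absolutelyContinuous _ _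

lemma nullSingletonClass_of_absolutelyContinuous (h : μ ≪ volume) : NullSingletonClass μ :=
  ⟨fun _ => h (measure_singleton _)⟩

lemma IsDensity.apply {f : ℝ → ℝ} (hf : IsDensity μ f) (s : Set ℝ) :
    μ s = ∫⁻ x in s, ENNReal.ofReal (f x) := by
  conv_lhs => rw [hf.eq_withDensity]
  rw [withDensity_apply']

lemma IsDensity.measure_eq_zero_iff {f : ℝ → ℝ} (hf : IsDensity μ f) (s : Set ℝ) :
    μ s = 0 ↔ volume ({x | 0 < f x} ∩ s) = 0 := by
  conv_lhs => rw [hf.eq_withDensity]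
  rw [withDensity_apply_eq_zero' hf.measurable.ennreal_ofReal.aemeasurable]
  simp

/-- The survival function lies below the exponential with the hazard rate of the point of
contact, if the hazard rate is larger to the right of it, and smaller to the left of it. -/
lemma IsDensity.survival_le_mul_exp [IsProbabilityMeasure μ] {f : ℝ → ℝ} (hf : IsDensity μ f)
    {c z : ℝ} (hc : 0 ≤ c) (hr : ∀ᵐ t, z < t → c * survival μ t ≤ f t)
    (hl : ∀ᵐ t, t < z → f t ≤ c * survival μ t) (u : ℝ) :
    survival μ u ≤ survival μ z * Real.exp (-c * (u - z)) := by
  have := nullSingletonClass_of_absolutelyContinuous hf.absolutelyContinuous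
  rcases le_total z u with hu | hu
  · refine survival_le_mul_exp_of_le (fun x y hzx hxy => ?_) hu
    rw [survival_sub hxy.le, Measure.real, measure_congr Ioo_ae_eq_Ico.symm, hf.apply,
      ← ENNReal.ofReal_le_iff_le_toReal (by rw [← hf.apply]; exact measure_ne_top _ _),
      ENNReal.ofReal_mul (mul_nonneg hc (survival_nonneg μ y)), ← Real.volume_Ioo,
      ← setLIntegral_const]
    refine setLIntegral_mono_ae (by have := hf.measurable; fun_prop) ?_
    filter_upwards [hr] with t ht htxy
    refine ENNReal.ofReal_le_ofReal ((ht (hzx.trans_lt htxy.1)).trans' ?_)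
    exact mul_le_mul_of_nonneg_left (antitone_survival htxy.2.le) hc
  · refine survival_le_mul_exp_of_ge (fun x y hyz hxy => ?_) hu
    rw [survival_sub hxy.le, Measure.real, measure_congr Ioo_ae_eq_Ico.symm, hf.apply]
    refine ENNReal.toReal_le_of_le_ofReal (mul_nonneg (mul_nonneg hc (survival_nonneg μ x))
      (sub_pos.2 hxy).le) ?_
    rw [ENNReal.ofReal_mul (mul_nonneg hc (survival_nonneg μ x)), ← Real.volume_Ioo,
      ← setLIntegral_const]
    refine setLIntegral_mono_ae aemeasurable_const ?_
    filter_upwards [hl] with t ht htxy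
    refine ENNReal.ofReal_le_ofReal ((ht (htxy.2.trans_le hyz)).trans ?_)
    exact mul_le_mul_of_nonneg_left (antitone_survival htxy.1.le) hc

/-- An inequality between a convex combination and the supporting exponentials at it. -/
lemma rpow_mul_rpow_le_of_le_mul_exp {S : ℝ → ℝ} (hS : ∀ x, 0 ≤ S x) {x y a b c : ℝ} (ha : 0 < a)
    (hb : 0 < b) (hab : a + b = 1)
    (h : ∀ u, S u ≤ S (a * x + b * y) * Real.exp (-c * (u - (a * x + b * y)))) :
    S x ^ a * S y ^ b ≤ S (a * x + b * y) := by
  set z := a * x + b * y with hz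
  calc S x ^ a * S y ^ b
      ≤ (S z * Real.exp (-c * (x - z))) ^ a * (S z * Real.exp (-c * (y - z))) ^ b :=
        mul_le_mul (Real.rpow_le_rpow (hS _) (h x) ha.le) (Real.rpow_le_rpow (hS _) (h y) hb.le)
          (Real.rpow_nonneg (hS _) _)
          (Real.rpow_nonneg (mul_nonneg (hS _) (Real.exp_pos _).le) _)
    _ = (S z ^ a * S z ^ b) *
        (Real.exp (-c * (x - z) * a) * Real.exp (-c * (y - z) * b)) := by
        rw [Real.mul_rpow (hS _) (Real.exp_pos _).le, Real.mul_rpow (hS _) (Real.exp_pos _).le,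
          Real.exp_mul (-c * (x - z)), Real.exp_mul (-c * (y - z)), mul_mul_mul_comm]
    _ = S z := by
        rw [← Real.rpow_add_of_nonneg (hS _) ha.le hb.le, hab, Real.rpow_one, ← Real.exp_add]
        have : -c * (x - z) * a + -c * (y - z) * b = 0 := by
          have : b = 1 - a := by linarith
          rw [hz, this]; ring
        rw [this, Real.exp_zero, mul_one]

/-- Distributions with a monotone hazard rate have log-concave tails. -/
theorem IsMHR.isLogConcave_survival [IsProbabilityMeasure μ] (h : IsMHR μ) :
    IsLogConcave (survival μ) := by
  obtain ⟨a, b, f, hab, hf, hpos, hzero, hmono⟩ := h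
  have hac := hf.absolutelyContinuous
  have := nullSingletonClass_of_absolutelyContinuous hac
  have hSpos : ∀ t : ℝ, (t : EReal) < b → 0 < survival μ t := by
    intro t ht
    have hlt : ((max a t : ℝ) : EReal) < b := by
      rcases max_choice a t with h | h <;> rw [h] <;> assumption
    obtain ⟨d, hd1, hd2⟩ := EReal.lt_iff_exists_real_btwn.1 hlt
    have hd1' : max a t < d := by exact_mod_cast hd1
    refine ENNReal.toReal_pos (fun h0 => ?_) (measure_ne_top _ _)
    rw [hf.measure_eq_zero_iff] at h0
    have hsub : Set.Ioo (max a t) d ⊆ {x | 0 < f x} ∩ Set.Ici t := fun x hx =>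
      ⟨hpos x ((le_max_left _ _).trans_lt hx.1)
        ((EReal.coe_lt_coe_iff.2 hx.2).trans hd2), ((le_max_right _ _).trans_lt hx.1).le⟩
    have := measure_mono_null hsub h0
    rw [Real.volume_Ioo, ENNReal.ofReal_eq_zero] at this
    linarith
  have hS0 : ∀ t : ℝ, b ≤ (t : EReal) → survival μ t = 0 := by
    intro t ht
    rw [survival, ← measureReal_congr (Ioi_ae_eq_Ici (a := t)), Measure.real,
      (hf.measure_eq_zero_iff _).2, ENNReal.toReal_zero]
    refine measure_mono_null (fun x hx => ?_) measure_empty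
    have h1 : 0 < f x := hx.1
    rw [hzero x (Or.inr (ht.trans_lt (EReal.coe_lt_coe_iff.2 hx.2)))] at h1
    exact absurd h1 (lt_irrefl _)
  have hS1 : ∀ t ≤ a, survival μ t = 1 := by
    intro t ht
    have : μ (Set.Iio t) = 0 := by
      rw [hf.measure_eq_zero_iff]
      refine measure_mono_null (fun x hx => ?_) measure_empty
      have h1 : 0 < f x := hx.1
      rw [hzero x (Or.inl (hx.2.trans_le ht))] at h1
      exact absurd h1 (lt_irrefl _)
    rw [survival, ← Set.compl_Iio, probReal_compl_eq_one_sub measurableSet_Iio, Measure.real, this]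
    simp
  -- The density is unconstrained at the endpoints of its interval, so these are discarded as null
  -- sets.
  have hae_b : ∀ᵐ t : ℝ, (t : EReal) ≠ b := by
    have : ({t : ℝ | (t : EReal) = b} : Set ℝ).Subsingleton := fun s hs t ht =>
      EReal.coe_injective (hs.trans ht.symm)
    have := this.measure_zero volume
    rw [ae_iff]; simpa using this
  have hae_a : ∀ᵐ t : ℝ, t ≠ a := by
    rw [ae_iff]; simp
  have hrate : ∀ t : ℝ, (t : EReal) < b → f t = hazardRate μ f t * survival μ t := by
    intro t ht
    rw [hazardRate, ← survival_eq_one_sub_cdf, div_mul_cancel₀ _ (hSpos t ht).ne']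
  refine ⟨survival_nonneg μ, fun x y s t hs ht hst => ?_⟩
  rw [smul_eq_mul, smul_eq_mul]
  set z := s * x + t * y with hz
  -- For z ≤ a the tail at z is 1, and for z ≥ b one of x, y is also beyond b, where the tail is 0.
  -- In between, the exponential whose rate is the hazard rate at z supports the tail there.
  rcases le_or_gt z a with hza | hza
  · rw [hS1 z hza]
    exact mul_le_one₀ (Real.rpow_le_one (survival_nonneg μ x) (survival_le_one x) hs.le)
      (Real.rpow_nonneg (survival_nonneg μ y) _)
      (Real.rpow_le_one (survival_nonneg μ y) (survival_le_one y) ht.le)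
  rcases le_or_gt b z with hzb | hzb
  · have : z ≤ x ∨ z ≤ y := by
      by_contra! hcon
      have h1 := mul_lt_mul_of_pos_left hcon.1 hs
      have h2 := mul_lt_mul_of_pos_left hcon.2 ht
      have h3 : s * z + t * z = z := by rw [← add_mul, hst, one_mul]
      linarith
    rcases this with h | h
    · rw [hS0 x (hzb.trans (EReal.coe_le_coe_iff.2 h)), Real.zero_rpow hs.ne', zero_mul]
      exact survival_nonneg μ _
    · rw [hS0 y (hzb.trans (EReal.coe_le_coe_iff.2 h)), Real.zero_rpow ht.ne', mul_zero]
      exact survival_nonneg μ _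
  · refine rpow_mul_rpow_le_of_le_mul_exp (c := hazardRate μ f z) (survival_nonneg μ) hs ht hst ?_
    refine hf.survival_le_mul_exp (c := hazardRate μ f z) (z := z) ?_ ?_ ?_
    · rw [hazardRate, ← survival_eq_one_sub_cdf]
      exact div_nonneg (hf.nonneg _) (survival_nonneg μ _)
    · filter_upwards [hae_b] with r hr hzr
      rcases lt_or_ge (r : EReal) b with hrb | hrb
      · rw [hrate r hrb]
        exact mul_le_mul_of_nonneg_right (hmono ⟨hza, hzb⟩ ⟨hza.trans hzr, hrb⟩ hzr.le)
          (survival_nonneg μ r)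
      · rw [hS0 r hrb, mul_zero]
        exact hf.nonneg r
    · filter_upwards [hae_a] with r hr hzr
      have hrb : (r : EReal) < b := (EReal.coe_lt_coe_iff.2 hzr).trans hzb
      rcases lt_or_gt_of_ne hr with hra | hra
      · rw [hzero r (Or.inl hra)]
        refine mul_nonneg ?_ (survival_nonneg μ r)
        rw [hazardRate, ← survival_eq_one_sub_cdf]
        exact div_nonneg (hf.nonneg _) (survival_nonneg μ _)
      · rw [hrate r hrb]
        exact mul_le_mul_of_nonneg_right (hmono ⟨hra, hrb⟩ ⟨hza, hzb⟩ hzr.le)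
          (survival_nonneg μ r)

end

/-! ### The virtual value of a distribution with a log-concave tail -/

section
variable {μ : Measure ℝ} {g : ℝ → ℝ}

/-- The points of the support at which the survival function has the derivative that is given by
the density, and at which the density is positive. -/
def regularPoints (μ : Measure ℝ) (g : ℝ → ℝ) : Set ℝ :=
  {x | x ∈ μ.support ∧ HasDerivAt (survival μ) (-g x) x ∧ 0 < g x}

/-- A zero of the tail is a minimum, so the derivative there would vanish. -/
lemma survival_pos_of_mem_regularPoints {x : ℝ} (hx : x ∈ regularPoints μ g) :
    0 < survival μ x := by
  refine (survival_nonneg μ x).lt_of_ne' fun h0 => ?_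
  have hmin : IsLocalMin (survival μ) x := Eventually.of_forall fun y => by
    rw [h0]; exact survival_nonneg μ y
  have := hmin.hasDerivAt_eq_zero hx.2.1
  linarith [hx.2.2]

lemma rate_pos {x : ℝ} (hx : x ∈ regularPoints μ g) : 0 < g x / survival μ x :=
  div_pos hx.2.2 (survival_pos_of_mem_regularPoints hx)

lemma measure_pos_of_mem_support {p : ℝ} (hp : p ∈ μ.support) {U : Set ℝ} (hU : U ∈ 𝓝 p) :
    0 < μ U := (Measure.mem_support_iff_forall p).1 hp U hU

lemma exists_mem_of_measure_pos {s : Set ℝ} (hs : 0 < μ s) {P : ℝ → Prop} (hP : ∀ᵐ x ∂μ, P x) :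
    ∃ x ∈ s, P x := by
  by_contra! hcon
  exact hs.ne' (measure_mono_null (fun x hx => hcon x hx) (ae_iff.1 hP))

/-- A distribution on the nonnegative reals with a density and a log-concave tail. -/
structure IsRegular (μ : Measure ℝ) (g : ℝ → ℝ) : Prop where
  density : IsDensity μ g
  logConcave : IsLogConcave (survival μ)
  measure_Iio : μ (Set.Iio 0) = 0

/-- A log-concave tail lies below the exponentials that are tangent to it. -/
lemma IsRegular.survival_le_mul_exp (h : IsRegular μ g) {x : ℝ} (hx : x ∈ regularPoints μ g)
    (u : ℝ) : survival μ u ≤ survival μ x * Real.exp (-(g x / survival μ x) * (u - x)) := by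
  have hSx := survival_pos_of_mem_regularPoints hx
  rcases (survival_nonneg μ u).eq_or_lt with hu | hu
  · rw [← hu]; positivity
  -- Along the segment from x to u the logarithm of the tail is concave, so its slope at x dominates
  -- the chord up to u.
  have hline : HasDerivAt (fun t : ℝ => x + t * (u - x)) (u - x) 0 := by
    simpa using ((hasDerivAt_id (0 : ℝ)).mul_const (u - x)).const_add x
  have hd : HasDerivAt (fun t : ℝ => Real.log (survival μ (x + t * (u - x))))
      (-g x * (u - x) / survival μ x) 0 := by
    have hx' : HasDerivAt (survival μ) (-g x) (x + 0 * (u - x)) := by simpa using hx.2.1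
    have := (hx'.comp (0 : ℝ) hline).log (by simpa using hSx.ne')
    simpa using this
  have hlim := hd.tendsto_slope_zero_right
  have hle : Real.log (survival μ u) - Real.log (survival μ x) ≤
      -g x * (u - x) / survival μ x := by
    refine ge_of_tendsto hlim ?_
    filter_upwards [Ioo_mem_nhdsGT (zero_lt_one' ℝ)] with t ht
    have h1 := h.logConcave.rpow_mul_le u x t (1 - t) ht.1 (sub_pos.2 ht.2) (by ring)
    have e : t • u + (1 - t) • x = x + t * (u - x) := by simp only [smul_eq_mul]; ring
    rw [e] at h1
    have h2 := Real.log_le_log (by positivity) h1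
    rw [Real.log_mul (by positivity) (by positivity), Real.log_rpow hu, Real.log_rpow hSx] at h2
    simp only [zero_add, zero_mul, add_zero, smul_eq_mul]
    rw [inv_mul_eq_div, le_div_iff₀ ht.1]
    linarith
  have h3 : Real.log (survival μ u) ≤ Real.log (survival μ x * Real.exp
      (-(g x / survival μ x) * (u - x))) := by
    rw [Real.log_mul hSx.ne' (Real.exp_pos _).ne', Real.log_exp]
    have : -(g x / survival μ x) * (u - x) = -g x * (u - x) / survival μ x := by ring
    rw [this]; linarith
  exact (Real.log_le_log_iff hu (by positivity)).1 h3

/-- Without atoms, a set of positive mass contains two distinct good points. Strict monotonicity on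
regular points can then be contradicted by almost-everywhere sign conditions. -/
lemma exists_lt_of_measure_pos [NullSingletonClass μ] {s : Set ℝ} (hs : 0 < μ s) {P : ℝ → Prop}
    (hP : ∀ᵐ x ∂μ, P x) : ∃ x ∈ s, ∃ y ∈ s, x < y ∧ P x ∧ P y := by
  obtain ⟨x, hx, hPx⟩ := exists_mem_of_measure_pos hs hP
  have hx' : ∀ᵐ y ∂μ, y ≠ x := by rw [ae_iff]; simp
  obtain ⟨y, hy, hPy, hyx⟩ := exists_mem_of_measure_pos hs (hP.and hx')
  rcases lt_or_gt_of_ne hyx with hlt | hlt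
  · exact ⟨y, hy, x, hx, hlt, hPy, hPx⟩
  · exact ⟨x, hx, y, hy, hlt, hPx, hPy⟩

/-- The tangent exponential at x bounds the tail at y, and vice versa. Adding the two logarithmic
inequalities leaves (rate y - rate x)·(y - x) ≥ 0. -/
lemma IsRegular.monotoneOn_rate (h : IsRegular μ g) :
    MonotoneOn (fun x => g x / survival μ x) (regularPoints μ g) := by
  intro x hx y hy hxy
  rcases hxy.eq_or_lt with rfl | hxy
  · exact le_rfl
  have hSx := survival_pos_of_mem_regularPoints hx
  have hSy := survival_pos_of_mem_regularPoints hy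
  have h1 := Real.log_le_log hSy (h.survival_le_mul_exp hx y)
  have h2 := Real.log_le_log hSx (h.survival_le_mul_exp hy x)
  rw [Real.log_mul (by positivity) (by positivity), Real.log_exp] at h1 h2
  dsimp only
  by_contra! hcon
  nlinarith

variable [IsProbabilityMeasure μ]


/-! ### Regular points have full measure. -/

lemma IsDensity.integrable (hg : IsDensity μ g) : Integrable g := by
  refine ⟨hg.measurable.aestronglyMeasurable, ?_⟩
  rw [hasFiniteIntegral_iff_ofReal (ae_of_all _ hg.nonneg), ← setLIntegral_univ, ← hg.apply]
  exact measure_lt_top _ _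

lemma IsDensity.intervalIntegral_eq (hg : IsDensity μ g) (x y : ℝ) :
    ∫ t in x..y, g t = survival μ x - survival μ y := by
  have key : ∀ x y : ℝ, x ≤ y → ∫ t in x..y, g t = survival μ x - survival μ y := by
    intro x y hxy
    have := nullSingletonClass_of_absolutelyContinuous hg.absolutelyContinuous
    rw [intervalIntegral.integral_of_le hxy, survival_sub hxy,
      measureReal_congr Ico_ae_eq_Ioc, Measure.real, hg.apply,
      integral_eq_lintegral_of_nonneg_ae (ae_of_all _ hg.nonneg)
        hg.measurable.aestronglyMeasurable]
  rcases le_total x y with h | h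
  · exact key x y h
  · rw [intervalIntegral.integral_symm, key y x h]; ring

/-- This is Lebesgue's differentiation theorem for the integral of the density. -/
lemma IsDensity.ae_hasDerivAt_survival (hg : IsDensity μ g) :
    ∀ᵐ x, HasDerivAt (survival μ) (-g x) x := by
  filter_upwards [LocallyIntegrable.ae_hasDerivAt_integral hg.integrable.locallyIntegrable] with x hx
  have h1 := (hx 0).const_sub (survival μ 0)
  refine h1.congr_of_eventuallyEq (Eventually.of_forall fun y => ?_)
  dsimp only
  rw [hg.intervalIntegral_eq]; ring

/-- The density is an arbitrary version, so its pointwise values are usable only at regular points.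
These carry all the mass. -/
lemma IsDensity.ae_mem_regularPoints (hg : IsDensity μ g) : ∀ᵐ x ∂μ, x ∈ regularPoints μ g := by
  have h1 : ∀ᵐ x ∂μ, 0 < g x := by
    rw [ae_iff, hg.measure_eq_zero_iff]
    refine measure_mono_null (fun x hx => hx.2 hx.1) measure_empty
  filter_upwards [Measure.support_mem_ae (μ := μ), hg.absolutelyContinuous.ae_le
    hg.ae_hasDerivAt_survival, h1] with x hx1 hx2 hx3
  exact ⟨hx1, hx2, hx3⟩

lemma survival_eq_one_of_measure_Iio {x : ℝ} (h : μ (Set.Iio x) = 0) : survival μ x = 1 := by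
  rw [survival, ← Set.compl_Iio, probReal_compl_eq_one_sub measurableSet_Iio, Measure.real, h]
  simp

lemma measure_Iio_of_survival_eq_one {x : ℝ} (h : survival μ x = 1) : μ (Set.Iio x) = 0 := by
  rw [survival, ← Set.compl_Iio, probReal_compl_eq_one_sub measurableSet_Iio] at h
  have : μ.real (Set.Iio x) = 0 := by linarith
  exact (measureReal_eq_zero_iff).1 this

lemma IsRegular.survival_eq_one (h : IsRegular μ g) {x : ℝ} (hx : x ≤ 0) : survival μ x = 1 :=
  survival_eq_one_of_measure_Iio (measure_mono_null (Set.Iio_subset_Iio hx) h.measure_Iio)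

lemma IsRegular.pos_of_mem (h : IsRegular μ g) {x : ℝ} (hx : x ∈ regularPoints μ g) : 0 < x := by
  by_contra! hx0
  have hmax : IsLocalMax (survival μ) x := Eventually.of_forall fun y => by
    rw [h.survival_eq_one hx0]; exact survival_le_one y
  have := hmax.hasDerivAt_eq_zero hx.2.1
  linarith [hx.2.2]

lemma IsRegular.virtualValue_eq (h : IsRegular μ g) (x : ℝ) :
    virtualValue μ g x = x - (g x / survival μ x)⁻¹ := by
  have := nullSingletonClass_of_absolutelyContinuous h.density.absolutelyContinuous
  rw [virtualValue, ← survival_eq_one_sub_cdf, inv_div]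

/-- The reciprocal of a nondecreasing rate is nonincreasing, and subtracting it from x gives strict
growth. -/
lemma IsRegular.strictMonoOn_virtualValue (h : IsRegular μ g) :
    StrictMonoOn (virtualValue μ g) (regularPoints μ g) := by
  intro x hx y hy hxy
  rw [h.virtualValue_eq, h.virtualValue_eq]
  have := inv_anti₀ (rate_pos hx) (h.monotoneOn_rate hx hy hxy.le)
  dsimp only at this
  linarith

/-- If a log-concave tail is flat and positive somewhere, then it is one there. -/
lemma IsRegular.survival_eq_one_of_flat (h : IsRegular μ g) {x y : ℝ} (hxy : x < y)
    (heq : survival μ x = survival μ y) (hpos : 0 < survival μ y) : survival μ y = 1 := by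
  -- This point lies to the left of x and has tail 1. Log-concavity on u < x < y gives S(y)^θ ≤ S(x)
  -- = S(y) with θ < 1, which is impossible for 0 < S(y) < 1.
  set u := min 0 (x - 1) with hu
  have hux : u < x := (min_le_right _ _).trans_lt (by linarith)
  have huy : 0 < y - u := by linarith
  have hSu : survival μ u = 1 := h.survival_eq_one (min_le_left _ _)
  have h1 := h.logConcave.rpow_mul_le u y ((y - x) / (y - u)) ((x - u) / (y - u))
    (div_pos (by linarith) huy) (div_pos (by linarith) huy) (by field_simp; ring)
  have e : ((y - x) / (y - u)) • u + ((x - u) / (y - u)) • y = x := by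
    simp only [smul_eq_mul]; field_simp; ring
  rw [e, hSu, Real.one_rpow, one_mul, heq] at h1
  refine le_antisymm (survival_le_one y) ?_
  by_contra! hlt
  have h2 : (x - u) / (y - u) < 1 := (div_lt_one huy).2 (by linarith)
  have h3 := Real.rpow_lt_rpow_of_exponent_gt hpos hlt h2
  rw [Real.rpow_one] at h3
  linarith

/-- A gap to the right of p would make the tail flat and positive, hence equal to 1, leaving no mass
near p. Together with its left counterpart this lets regular points approach p from a chosen side.
-/
lemma IsRegular.measure_Ioo_right_pos (h : IsRegular μ g) {p q : ℝ} (hp : p ∈ μ.support)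
    (hS : 0 < survival μ p) (hpq : p < q) : 0 < μ (Set.Ioo p q) := by
  have := nullSingletonClass_of_absolutelyContinuous h.density.absolutelyContinuous
  rw [pos_iff_ne_zero]
  intro h0
  have h1 := survival_sub (μ := μ) hpq.le
  rw [measureReal_congr Ioo_ae_eq_Ico.symm, Measure.real, h0, ENNReal.toReal_zero] at h1
  have h2 : survival μ p = survival μ q := by linarith
  have h3 := measure_Iio_of_survival_eq_one (h.survival_eq_one_of_flat hpq h2 (h2 ▸ hS))
  exact (measure_pos_of_mem_support hp (Iio_mem_nhds hpq)).ne' h3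

lemma survival_pos_of_lt_of_mem_support {p q : ℝ} (hq : q ∈ μ.support) (hpq : p < q) :
    0 < survival μ p :=
  ENNReal.toReal_pos (measure_pos_of_mem_support hq (Ici_mem_nhds hpq)).ne' (measure_ne_top _ _)

lemma IsRegular.measure_Ioo_left_pos (h : IsRegular μ g) {p q : ℝ} (hq : q ∈ μ.support)
    (hS : survival μ q ≠ 1) (hpq : p < q) : 0 < μ (Set.Ioo p q) := by
  have := nullSingletonClass_of_absolutelyContinuous h.density.absolutelyContinuous
  rw [pos_iff_ne_zero]
  intro h0
  have h1 := survival_sub (μ := μ) hpq.le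
  rw [measureReal_congr Ioo_ae_eq_Ico.symm, Measure.real, h0, ENNReal.toReal_zero] at h1
  have h2 : survival μ p = survival μ q := by linarith
  exact hS (h.survival_eq_one_of_flat hpq h2 (h2 ▸ survival_pos_of_lt_of_mem_support hq hpq))

/-- The virtual value crosses zero. -/
lemma IsRegular.exists_isVirtualValueZero (h : IsRegular μ g) :
    ∃ p, IsVirtualValueZero μ g p := by
  have hD := h.density.ae_mem_regularPoints
  obtain ⟨d, -, hd⟩ := exists_mem_of_measure_pos (μ := μ) (s := Set.univ) (by simp) hD
  have hmono := h.strictMonoOn_virtualValue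
  have hclosed : IsClosed μ.support := Measure.isClosed_support
  set A := {x ∈ regularPoints μ g | virtualValue μ g x ≤ 0} with hA
  -- If the virtual value is positive at all regular points, the zero is their infimum. Otherwise it
  -- is the supremum of those with nonpositive virtual value.
  rcases A.eq_empty_or_nonempty with hAe | ⟨x₀, hx₀, hx₀'⟩
  · have hbdd : BddBelow (regularPoints μ g) := ⟨0, fun x hx => (h.pos_of_mem hx).le⟩
    refine ⟨sInf (regularPoints μ g), ?_, ?_⟩
    · exact closure_minimal (fun x hx => hx.1) hclosed (csInf_mem_closure ⟨d, hd⟩ hbdd)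
    · filter_upwards [hD] with x hx
      refine ⟨fun hlt => absurd (csInf_le hbdd hx) (not_le.2 hlt), fun _ => ?_⟩
      by_contra! hcon
      exact (Set.eq_empty_iff_forall_notMem.1 hAe x) ⟨hx, hcon.le⟩
  · have hbdd : BddAbove A := by
      -- A point x ≥ x₀ of A satisfies x ≤ 1/rate(x) ≤ 1/rate(x₀).
      refine ⟨max x₀ (g x₀ / survival μ x₀)⁻¹, fun x hx => ?_⟩
      rcases le_total x x₀ with hle | hle
      · exact hle.trans (le_max_left _ _)
      · have h1 := inv_anti₀ (rate_pos hx₀) (h.monotoneOn_rate hx₀ hx.1 hle)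
        have h2 := hx.2
        rw [h.virtualValue_eq] at h2
        dsimp only at h1
        exact le_max_of_le_right (by linarith)
    refine ⟨sSup A, ?_, ?_⟩
    · exact closure_minimal (fun x hx => hx.1.1) hclosed
        (csSup_mem_closure ⟨x₀, hx₀, hx₀'⟩ hbdd)
    · filter_upwards [hD] with x hx
      refine ⟨fun hlt => ?_, fun hlt => ?_⟩
      · obtain ⟨y, hy, hxy⟩ := exists_lt_of_lt_csSup (s := A) ⟨x₀, hx₀, hx₀'⟩ hlt
        exact (hmono hx hy.1 hxy).le.trans hy.2
      · by_contra! hcon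
        exact absurd (le_csSup hbdd ⟨hx, hcon.le⟩) (not_le.2 hlt)

/-- Between two zeros p < q the virtual value is both nonnegative and nonpositive almost everywhere.
That interval has positive mass, hence two regular points at which strict monotonicity fails. -/
lemma IsRegular.isVirtualValueZero_le (h : IsRegular μ g) {p q : ℝ}
    (hp : IsVirtualValueZero μ g p) (hq : IsVirtualValueZero μ g q) : q ≤ p := by
  have := nullSingletonClass_of_absolutelyContinuous h.density.absolutelyContinuous
  by_contra! hpq
  have hpos := h.measure_Ioo_right_pos hp.1 (survival_pos_of_lt_of_mem_support hq.1 hpq) hpq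
  obtain ⟨x, hx, y, hy, hxy, ⟨hxD, hxp, hxq⟩, hyD, hyp, hyq⟩ :=
    exists_lt_of_measure_pos hpos (h.density.ae_mem_regularPoints.and (hp.2.and hq.2))
  have := h.strictMonoOn_virtualValue hxD hyD hxy
  linarith [hxp.2 hx.1, hyq.1 hy.2]

/-- The virtual value crosses zero at exactly one point. -/
theorem IsRegular.existsUnique_isVirtualValueZero (h : IsRegular μ g) :
    ∃! p, IsVirtualValueZero μ g p := by
  obtain ⟨p, hp⟩ := h.exists_isVirtualValueZero
  exact ⟨p, hp, fun q hq =>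
    le_antisymm (h.isVirtualValueZero_le hp hq) (h.isVirtualValueZero_le hq hp)⟩

/-- Regular points x close to 0 have rate at most that of a fixed d, so their virtual value is at
most x - 1/rate(d) < 0. This rules out a zero at 0, and there is no mass below 0. -/
lemma IsRegular.isVirtualValueZero_pos (h : IsRegular μ g) {p : ℝ}
    (hp : IsVirtualValueZero μ g p) : 0 < p := by
  have hD := h.density.ae_mem_regularPoints
  obtain ⟨d, -, hd⟩ := exists_mem_of_measure_pos (μ := μ) (s := Set.univ) (by simp) hD
  by_contra! hp0
  rcases hp0.eq_or_lt with rfl | hp0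
  · have hδ : 0 < min d (g d / survival μ d)⁻¹ :=
      lt_min (h.pos_of_mem hd) (inv_pos.2 (rate_pos hd))
    obtain ⟨x, hx, hxD, hxp⟩ := exists_mem_of_measure_pos
      (measure_pos_of_mem_support hp.1 (Iio_mem_nhds hδ)) (hD.and hp.2)
    have hx' : x < min d (g d / survival μ d)⁻¹ := hx
    have h1 := hxp.2 (h.pos_of_mem hxD)
    rw [h.virtualValue_eq] at h1
    have h2 := inv_anti₀ (rate_pos hxD)
      (h.monotoneOn_rate hxD hd (hx'.trans_le (min_le_left _ _)).le)
    have h3 := hx'.trans_le (min_le_right _ _)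
    dsimp only at h2
    linarith
  · exact (measure_pos_of_mem_support hp.1 (Iio_mem_nhds hp0)).ne' h.measure_Iio

/-- The sign of the virtual value at a regular x compares the rate with 1/x: rate ≤ 1/x to the left
of p, rate ≥ 1/x to the right. For x strictly between u and p the tangent at x thus gives S(u) ≤
S(x)·exp(1 - u/x). Letting x tend to p avoids any regularity at p itself. -/
lemma IsRegular.survival_le_of_isVirtualValueZero (h : IsRegular μ g) {p : ℝ}
    (hp : IsVirtualValueZero μ g p) (u : ℝ) :
    survival μ u ≤ survival μ p * Real.exp (1 - u / p) := by
  have := nullSingletonClass_of_absolutelyContinuous h.density.absolutelyContinuous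
  have hD := h.density.ae_mem_regularPoints
  have hp0 := h.isVirtualValueZero_pos hp
  have hSp := survival_nonneg μ p
  have hlim : Tendsto (fun x => survival μ x * Real.exp (1 - u / x)) (𝓝 p)
      (𝓝 (survival μ p * Real.exp (1 - u / p))) := by
    have h1 : ContinuousAt (fun x => Real.exp (1 - u / x)) p := by
      have := hp0.ne'
      fun_prop (disch := assumption)
    exact (continuous_survival.tendsto p).mul h1
  have hstep : ∀ x ∈ regularPoints μ g,
      (g x / survival μ x) * (x - u) ≤ 1 - u / x →
      survival μ u ≤ survival μ x * Real.exp (1 - u / x) := by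
    intro x hx hle
    refine (h.survival_le_mul_exp hx u).trans ?_
    refine mul_le_mul_of_nonneg_left (Real.exp_le_exp.2 ?_) (survival_nonneg μ x)
    linarith
  rcases lt_trichotomy u p with hup | rfl | hup
  · by_cases hS1 : survival μ p = 1
    · rw [hS1, one_mul]
      refine (survival_le_one u).trans (Real.one_le_exp ?_)
      rw [sub_nonneg, div_le_one hp0]
      exact hup.le
    refine ge_of_tendsto_of_frequently hlim ?_
    rw [Metric.nhds_basis_ball.frequently_iff]
    intro δ hδ
    have hlt : max u (p - δ) < p := max_lt hup (by linarith)
    obtain ⟨x, hx, hxD, hxp⟩ := exists_mem_of_measure_pos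
      (h.measure_Ioo_left_pos hp.1 hS1 hlt) (hD.and hp.2)
    have hx1 := max_lt_iff.1 hx.1
    refine ⟨x, ?_, hstep x hxD ?_⟩
    · rw [Metric.mem_ball, Real.dist_eq, abs_lt]
      constructor <;> linarith [hx.2]
    · have h1 := hxp.1 hx.2
      rw [h.virtualValue_eq, sub_nonpos] at h1
      have hx0 := h.pos_of_mem hxD
      have h2 := (le_inv_comm₀ hx0 (rate_pos hxD)).1 h1
      calc g x / survival μ x * (x - u) ≤ x⁻¹ * (x - u) :=
            mul_le_mul_of_nonneg_right h2 (by linarith)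
        _ = 1 - u / x := by field_simp
  · simp [hp0.ne']
  · rcases hSp.eq_or_lt with hS0 | hS0
    · rw [← hS0, zero_mul, hS0]
      exact antitone_survival hup.le
    refine ge_of_tendsto_of_frequently hlim ?_
    rw [Metric.nhds_basis_ball.frequently_iff]
    intro δ hδ
    have hlt : p < min u (p + δ) := lt_min hup (by linarith)
    obtain ⟨x, hx, hxD, hxp⟩ := exists_mem_of_measure_pos
      (h.measure_Ioo_right_pos hp.1 hS0 hlt) (hD.and hp.2)
    have hx1 := lt_min_iff.1 hx.2
    refine ⟨x, ?_, hstep x hxD ?_⟩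
    · rw [Metric.mem_ball, Real.dist_eq, abs_lt]
      constructor <;> linarith [hx.1]
    · have h1 := hxp.2 hx.1
      rw [h.virtualValue_eq, sub_nonneg] at h1
      have hx0 := h.pos_of_mem hxD
      have h2 := (inv_le_comm₀ (rate_pos hxD) hx0).1 h1
      calc g x / survival μ x * (x - u) ≤ x⁻¹ * (x - u) :=
            mul_le_mul_of_nonpos_right h2 (by linarith)
        _ = 1 - u / x := by field_simp

/-- The monopoly revenue is at least the fraction `1 / e` of the mean. -/
theorem IsRegular.lintegral_le (h : IsRegular μ g) {p : ℝ} (hp : IsVirtualValueZero μ g p) :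
    ∫⁻ x, ENNReal.ofReal x ∂μ ≤ ENNReal.ofReal (Real.exp 1 * (p * survival μ p)) := by
  have hp0 := h.isVirtualValueZero_pos hp
  have hneg : -p⁻¹ < 0 := neg_lt_zero.2 (inv_pos.2 hp0)
  have hnn : 0 ≤ᵐ[μ] fun x : ℝ => x := by
    change ∀ᵐ x ∂μ, 0 ≤ x
    rw [ae_iff]
    simpa [Set.Iio] using h.measure_Iio
  have hC : 0 ≤ Real.exp 1 * survival μ p := mul_nonneg (Real.exp_pos _).le (survival_nonneg μ p)
  -- The mean is the integral of the tail over t > 0, and exp(1 - t/p) integrates to e·p.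
  rw [lintegral_eq_lintegral_meas_le μ hnn aemeasurable_id]
  calc ∫⁻ t in Set.Ioi 0, μ {a | t ≤ a}
      ≤ ∫⁻ t in Set.Ioi 0,
          ENNReal.ofReal (Real.exp 1 * survival μ p * Real.exp (-p⁻¹ * t)) := by
        refine lintegral_mono fun t => ?_
        have h1 := h.survival_le_of_isVirtualValueZero hp t
        have e : survival μ p * Real.exp (1 - t / p) =
            Real.exp 1 * survival μ p * Real.exp (-p⁻¹ * t) := by
          rw [sub_eq_add_neg, Real.exp_add, neg_mul, inv_mul_eq_div]; ring
        rw [← e]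
        refine (ENNReal.le_ofReal_iff_toReal_le (measure_ne_top _ _) ?_).2 h1
        exact (survival_nonneg μ t).trans h1
    _ = ENNReal.ofReal (∫ t in Set.Ioi 0, Real.exp 1 * survival μ p * Real.exp (-p⁻¹ * t)) := by
        rw [ofReal_integral_eq_lintegral_ofReal]
        · exact (integrableOn_exp_mul_Ioi hneg 0).const_mul _
        · exact ae_of_all _ fun t => mul_nonneg hC (Real.exp_pos _).le
    _ = ENNReal.ofReal (Real.exp 1 * (p * survival μ p)) := by
        rw [integral_const_mul, integral_exp_mul_Ioi hneg]
        congr 1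
        simp
        ring

end

/-! ### Absolute continuity of the joint law -/

lemma absolutelyContinuous_pi {μ : Measure ℝ} [SigmaFinite μ] (h : μ ≪ volume) (n : ℕ) :
    (Measure.pi fun _ : Fin n => μ) ≪ volume := by
  induction n with
  | zero => rw [Measure.pi_of_empty _ (0 : Fin 0 → ℝ), volume_pi, Measure.pi_of_empty _ 0]
  | succ n ih =>
    have h1 := (measurePreserving_piFinSuccAbove (fun _ : Fin (n + 1) => μ) 0).symm
    have h2 := (volume_preserving_piFinSuccAbove (fun _ : Fin (n + 1) => ℝ) 0).symm
    rw [← h1.map_eq, ← h2.map_eq]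
    exact (h.prod ih).map (MeasurableEquiv.measurable _)

lemma volume_preimage_linearMap {n : ℕ} (L : (Fin n → ℝ) →ₗ[ℝ] ℝ) (hL : Function.Surjective L)
    {s : Set ℝ} (hs : MeasurableSet s) (h0 : volume s = 0) : volume (L ⁻¹' s) = 0 := by
  have := (ae_comp_linearMap_mem_iff L volume volume hL hs.compl).2
    (by rw [ae_iff]; simpa using h0)
  rw [ae_iff] at this
  refine measure_mono_null (fun v hv => ?_) this
  exact not_not.2 hv

lemma ae_injective {n : ℕ} : ∀ᵐ v : Fin n → ℝ, Function.Injective v := by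
  have : ∀ i j : Fin n, i ≠ j → ∀ᵐ v : Fin n → ℝ, v i ≠ v j := by
    intro i j hij
    let L : (Fin n → ℝ) →ₗ[ℝ] ℝ := 
      LinearMap.proj (R := ℝ) (φ := fun _ : Fin n => ℝ) i - LinearMap.proj j
    have hL : Function.Surjective L := fun c =>
      ⟨Pi.single i c, by simp [L, Pi.single_eq_of_ne hij.symm]⟩
    have := volume_preimage_linearMap L hL (measurableSet_singleton 0) (by simp)
    rw [ae_iff]
    refine measure_mono_null (fun v hv => ?_) this
    simpa [L, sub_eq_zero] using hv
  have h2 : ∀ᵐ v : Fin n → ℝ, ∀ i j : Fin n, i ≠ j → v i ≠ v j := by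
    simp only [ae_all_iff, eventually_imp_distrib_left]
    exact this
  filter_upwards [h2] with v hv i j hij
  by_contra hne
  exact hv i j hne hij

/-- At each v the sum is one of finitely many linear functionals, nonzero because 1 ≤ k ≤ n, and
each of these pulls null sets back to null sets. -/
lemma topSumLaw_absolutelyContinuous {F : Measure ℝ} [IsProbabilityMeasure F]
    (hF : F ≪ volume) {n k : ℕ} (hk : 1 ≤ k) (hkn : k ≤ n) : topSumLaw F n k ≪ volume := by
  refine Measure.AbsolutelyContinuous.mk fun s hs h0 => ?_
  rw [topSumLaw, Measure.map_apply (measurable_topSum k) hs]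
  refine absolutelyContinuous_pi hF n ?_
  let L : Equiv.Perm (Fin n) → (Fin n → ℝ) →ₗ[ℝ] ℝ := fun σ =>
    ∑ j : Fin n with j.val < k, LinearMap.proj (σ j)
  have hLv : ∀ σ v, L σ v = headSum k (v ∘ σ) := fun σ v => by simp [L, headSum]
  have hL : ∀ σ, Function.Surjective (L σ) := by
    intro σ c
    let z : Fin n := ⟨0, by omega⟩
    refine ⟨Pi.single (σ z) c, ?_⟩
    rw [hLv, headSum, Finset.sum_eq_single z]
    · simp
    · intro j _ hj
      simp [hj]
    · intro hz
      simp [z] at hz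
      omega
  refine measure_mono_null (t := ⋃ σ, L σ ⁻¹' s) (fun v hv => ?_)
    (measure_iUnion_null fun σ => volume_preimage_linearMap (L σ) (hL σ) hs h0)
  refine Set.mem_iUnion.2 ⟨sortDesc v, ?_⟩
  rw [Set.mem_preimage, hLv, ← topSum_eq_headSum]
  exact hv

/-! ### Symmetrization -/

lemma measurePreserving_comp_perm {n : ℕ} (μ : Measure ℝ) [SigmaFinite μ]
    (σ : Equiv.Perm (Fin n)) :
    MeasurePreserving (fun v : Fin n → ℝ => v ∘ σ) (Measure.pi fun _ => μ)
      (Measure.pi fun _ => μ) := by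
  have := measurePreserving_piCongrLeft (fun _ : Fin n => μ) σ.symm
  convert this using 1
  ext v i
  obtain ⟨j, rfl⟩ := σ.symm.surjective i
  simp [MeasurableEquiv.coe_piCongrLeft, Equiv.piCongrLeft_apply_apply]

lemma perm_eq_of_antitone {n : ℕ} {v : Fin n → ℝ} (hv : Function.Injective v)
    {σ τ : Equiv.Perm (Fin n)} (hσ : Antitone (v ∘ σ)) (hτ : Antitone (v ∘ τ)) : σ = τ := by
  have := Tuple.unique_monotone (f := fun i => -v i) (σ := σ) (τ := τ)
    (fun i j hij => neg_le_neg (hσ hij)) (fun i j hij => neg_le_neg (hτ hij))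
  ext i
  have h := congrFun this i
  simp only [Function.comp_apply, neg_inj] at h
  rw [hv h]

lemma measurableSet_antitone {n : ℕ} : MeasurableSet {v : Fin n → ℝ | Antitone v} :=
  isClosed_antitone.measurableSet

/-- The probability of a symmetric event, in terms of the decreasingly ordered vectors. -/
lemma measure_eq_factorial_mul {n : ℕ} {μ : Measure ℝ} [IsProbabilityMeasure μ]
    (h : μ ≪ volume) {A : Set (Fin n → ℝ)} (hA : MeasurableSet A)
    (hsymm : ∀ (σ : Equiv.Perm (Fin n)) v, v ∘ σ ∈ A ↔ v ∈ A) :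
    (Measure.pi fun _ => μ) A =
      n.factorial * (Measure.pi fun _ => μ) (A ∩ {v | Antitone v}) := by
  set π : Measure (Fin n → ℝ) := Measure.pi fun _ => μ
  have hpre : ∀ σ : Equiv.Perm (Fin n), A ∩ {v | Antitone (v ∘ σ)} =
      (fun v : Fin n → ℝ => v ∘ σ) ⁻¹' (A ∩ {v | Antitone v}) := by
    intro σ; ext v
    simp only [Set.mem_inter_iff, Set.mem_preimage, hsymm, Set.mem_ofPred_eq]
  have hmeas : ∀ σ : Equiv.Perm (Fin n), MeasurableSet (A ∩ {v | Antitone (v ∘ σ)}) := by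
    intro σ
    rw [hpre]
    exact (measurePreserving_comp_perm μ σ).measurable (hA.inter measurableSet_antitone)
  have hunion : A = ⋃ σ : Equiv.Perm (Fin n), A ∩ {v | Antitone (v ∘ σ)} := by
    ext v
    simp only [Set.mem_iUnion, Set.mem_inter_iff, Set.mem_ofPred_eq]
    exact ⟨fun hv => ⟨sortDesc v, hv, antitone_comp_sortDesc v⟩, fun ⟨_, hv, _⟩ => hv⟩
  -- Two chambers overlap only in vectors with ties, which form a null set.
  have hdisj : Pairwise (Function.onFun (AEDisjoint π)
      fun σ : Equiv.Perm (Fin n) => A ∩ {v | Antitone (v ∘ σ)}) := by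
    intro σ τ hστ
    have hinj : ∀ᵐ v ∂π, Function.Injective v := (absolutelyContinuous_pi h n).ae_le ae_injective
    refine measure_mono_null (fun v hv => ?_) (ae_iff.1 hinj)
    exact fun hinj => hστ (perm_eq_of_antitone hinj hv.1.2 hv.2.2)
  conv_lhs => rw [hunion]
  rw [measure_iUnion₀ hdisj fun σ => (hmeas σ).nullMeasurableSet, tsum_fintype]
  have : ∀ σ : Equiv.Perm (Fin n), π (A ∩ {v | Antitone (v ∘ σ)}) =
      π (A ∩ {v | Antitone v}) := fun σ => by
    rw [hpre]
    exact (measurePreserving_comp_perm μ σ).measure_preimage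
      (hA.inter measurableSet_antitone).nullMeasurableSet
  simp [this, Fintype.card_perm]

/-! ### The standard exponential distribution and quantiles -/

/-- The density of the standard exponential distribution. -/
def expDensity (x : ℝ) : ℝ := if 0 ≤ x then Real.exp (-x) else 0

/-- The standard exponential distribution. -/
def expLaw : Measure ℝ := volume.withDensity fun x => ENNReal.ofReal (expDensity x)

@[fun_prop]
lemma measurable_expDensity : Measurable expDensity :=
  Measurable.ite measurableSet_Ici (by fun_prop) measurable_const

lemma expDensity_nonneg (x : ℝ) : 0 ≤ expDensity x := by
  unfold expDensity; split_ifs <;> positivity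

lemma expDensity_le_one (x : ℝ) : expDensity x ≤ 1 := by
  unfold expDensity
  split_ifs with h
  · exact Real.exp_le_one_iff.2 (by linarith)
  · exact zero_le_one

lemma isLogConcave_expDensity : IsLogConcave expDensity := by
  refine ⟨expDensity_nonneg, fun x y a b ha hb hab => ?_⟩
  by_cases hx : 0 ≤ x
  · by_cases hy : 0 ≤ y
    · have : 0 ≤ a • x + b • y := by simp only [smul_eq_mul]; positivity
      rw [expDensity, expDensity, expDensity, if_pos hx, if_pos hy, if_pos this, ← Real.exp_mul,
        ← Real.exp_mul, ← Real.exp_add]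
      refine le_of_eq (congrArg _ ?_)
      simp only [smul_eq_mul]; ring
    · have : expDensity y = 0 := if_neg hy
      rw [this, Real.zero_rpow hb.ne', mul_zero]
      exact expDensity_nonneg _
  · have : expDensity x = 0 := if_neg hx
    rw [this, Real.zero_rpow ha.ne', zero_mul]
    exact expDensity_nonneg _

lemma expLaw_Ici {s : ℝ} (hs : 0 ≤ s) : expLaw (Set.Ici s) = ENNReal.ofReal (Real.exp (-s)) := by
  rw [expLaw, withDensity_apply _ measurableSet_Ici, setLIntegral_congr Ioi_ae_eq_Ici.symm,
    setLIntegral_congr_fun (g := fun x => ENNReal.ofReal (Real.exp (-x))) measurableSet_Ioi,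
    ← ofReal_integral_eq_lintegral_ofReal, integral_exp_neg_Ioi]
  · have := exp_neg_integrableOn_Ioi s one_pos
    simp only [neg_one_mul] at this
    exact this
  · exact ae_of_all _ fun x => (Real.exp_pos _).le
  · intro x hx
    have : 0 ≤ x := hs.trans (le_of_lt hx)
    simp [expDensity, this]

lemma expLaw_Iio : expLaw (Set.Iio 0) = 0 := by
  rw [expLaw, withDensity_apply _ measurableSet_Iio, setLIntegral_congr_fun (g := fun _ => 0)
    measurableSet_Iio, lintegral_zero]
  intro x hx
  simp [expDensity, not_le.2 (Set.mem_Iio.1 hx)]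

lemma expLaw_absolutelyContinuous : expLaw ≪ volume := withDensity_absolutelyContinuous _ _

instance : IsProbabilityMeasure expLaw := by
  constructor
  rw [← measure_add_measure_compl (measurableSet_Iio (a := (0 : ℝ))), Set.compl_Iio, expLaw_Iio,
    expLaw_Ici le_rfl]
  simp

lemma ae_expLaw_nonneg : ∀ᵐ x ∂expLaw, 0 ≤ x := by
  rw [ae_iff]
  simpa [Set.Iio] using expLaw_Iio

lemma integrable_expDensity : Integrable expDensity := by
  refine ⟨measurable_expDensity.aestronglyMeasurable, ?_⟩
  rw [hasFiniteIntegral_iff_ofReal (ae_of_all _ expDensity_nonneg), ← setLIntegral_univ,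
    ← withDensity_apply _ MeasurableSet.univ]
  exact measure_lt_top expLaw _

/-- The quantile of `F` at the level `1 - exp (-e)`. -/
def expQuantile (F : Measure ℝ) (e : ℝ) : ℝ :=
  -- Clamping e at 0 keeps the set nonempty for negative e, so that `le_expQuantile_iff` holds for
  -- every real e.
  sSup {x | Real.exp (-max e 0) ≤ survival F x}

section
variable {F : Measure ℝ} [IsProbabilityMeasure F]

/-- The set in the definition contains 0, is bounded because the tail tends to 0, and is closed
because the tail is continuous, so its supremum is attained. Monotonicity, push-forward and
concavity of the quantile all follow from this equivalence. -/
lemma le_expQuantile_iff [NullSingletonClass F] (h0 : F (Set.Iio 0) = 0) {x e : ℝ} :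
    x ≤ expQuantile F e ↔ Real.exp (-max e 0) ≤ survival F x := by
  set A := {x | Real.exp (-max e 0) ≤ survival F x} with hA
  have hne : A.Nonempty := ⟨0, by
    rw [hA, Set.mem_ofPred_eq, survival_eq_one_of_measure_Iio h0]
    exact Real.exp_le_one_iff.2 (by simp)⟩
  have hlim : Tendsto (survival F) atTop (𝓝 0) := by
    have : survival F = fun x => 1 - cdf F x := funext survival_eq_one_sub_cdf
    rw [this]
    simpa using (tendsto_cdf_atTop F).const_sub 1
  have hbdd : BddAbove A := by
    obtain ⟨y, hy⟩ := (hlim.eventually_lt_const (Real.exp_pos (-max e 0))).exists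
    refine ⟨y, fun x hx => ?_⟩
    by_contra! hyx
    exact absurd (hx.trans (antitone_survival hyx.le)) (not_le.2 hy)
  have hcl : IsClosed A := isClosed_le continuous_const continuous_survival
  constructor
  · intro hx
    have hmem : sSup A ∈ A := hcl.csSup_mem hne hbdd
    exact le_trans hmem (antitone_survival hx)
  · intro hx
    exact le_csSup hbdd hx

lemma monotone_expQuantile [NullSingletonClass F] (h0 : F (Set.Iio 0) = 0) :
    Monotone (expQuantile F) := by
  intro e e' hee
  rw [le_expQuantile_iff h0]
  refine le_trans ?_ ((le_expQuantile_iff h0).1 le_rfl)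
  exact Real.exp_le_exp.2 (neg_le_neg (max_le_max_right 0 hee))

/-- Inverse transform sampling: up to a null set the quantile is at least x exactly when e ≥ -log
S(x), an event of exponential probability S(x). -/
lemma map_expQuantile [NullSingletonClass F] (h0 : F (Set.Iio 0) = 0) :
    expLaw.map (expQuantile F) = F := by
  have hm := (monotone_expQuantile h0).measurable
  have := Measure.isProbabilityMeasure_map (μ := expLaw) hm.aemeasurable
  refine Measure.ext_of_Ici _ _ fun x => ?_
  rw [Measure.map_apply hm measurableSet_Ici]
  have hpre : expQuantile F ⁻¹' Set.Ici x = {e | Real.exp (-max e 0) ≤ survival F x} := by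
    ext e; exact le_expQuantile_iff h0
  have hF : F (Set.Ici x) = ENNReal.ofReal (survival F x) := (ofReal_measureReal).symm
  rw [hpre, hF]
  rcases (survival_nonneg F x).eq_or_lt with hS | hS
  · rw [← hS, ENNReal.ofReal_zero]
    refine measure_mono_null (fun e he => ?_) measure_empty
    exact absurd he (not_le.2 (Real.exp_pos _))
  · have hs : 0 ≤ -Real.log (survival F x) :=
      neg_nonneg.2 (Real.log_nonpos hS.le (survival_le_one x))
    have hae : {e | Real.exp (-max e 0) ≤ survival F x} =ᵐ[expLaw]
        Set.Ici (-Real.log (survival F x)) := by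
      filter_upwards [ae_expLaw_nonneg] with e he
      apply propext
      change Real.exp (-max e 0) ≤ survival F x ↔ -Real.log (survival F x) ≤ e
      rw [max_eq_left he, ← Real.le_log_iff_exp_le hS]
      exact neg_le
    rw [measure_congr hae, expLaw_Ici hs, neg_neg, Real.exp_log hS]

/-- Log-concavity of the tail, read through `le_expQuantile_iff`. The levels must be nonnegative
because the clamped level is not affine across 0. -/
lemma expQuantile_concave [NullSingletonClass F] (h0 : F (Set.Iio 0) = 0)
    (hF : IsLogConcave (survival F)) {e e' a b : ℝ} (he : 0 ≤ e) (he' : 0 ≤ e') (ha : 0 < a)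
    (hb : 0 < b) (hab : a + b = 1) :
    a * expQuantile F e + b * expQuantile F e' ≤ expQuantile F (a * e + b * e') := by
  rw [le_expQuantile_iff h0]
  have h1 := (le_expQuantile_iff h0 (x := expQuantile F e)).1 le_rfl
  have h2 := (le_expQuantile_iff h0 (x := expQuantile F e')).1 le_rfl
  rw [max_eq_left he] at h1
  rw [max_eq_left he'] at h2
  rw [max_eq_left (by positivity)]
  calc Real.exp (-(a * e + b * e')) = Real.exp (-e) ^ a * Real.exp (-e') ^ b := by
        rw [← Real.exp_mul, ← Real.exp_mul, ← Real.exp_add]; congr 1; ring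
    _ ≤ survival F (expQuantile F e) ^ a * survival F (expQuantile F e') ^ b :=
        mul_le_mul (Real.rpow_le_rpow (Real.exp_pos _).le h1 ha.le)
          (Real.rpow_le_rpow (Real.exp_pos _).le h2 hb.le)
          (Real.rpow_nonneg (Real.exp_pos _).le _) (Real.rpow_nonneg (survival_nonneg _ _) _)
    _ ≤ _ := hF.rpow_mul_le _ _ a b ha hb hab

/-! ### The tail of the sum of the highest valuations -/

lemma isLogConcave_indicator {E : Type*} [AddCommGroup E] [Module ℝ E] {K : Set E}
    (hK : Convex ℝ K) : IsLogConcave (K.indicator fun _ => (1 : ℝ)) := by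
  have hnn : ∀ x, 0 ≤ K.indicator (fun _ => (1 : ℝ)) x := fun x =>
    Set.indicator_nonneg (fun _ _ => zero_le_one) x
  refine ⟨hnn, fun x y a b ha hb hab => ?_⟩
  by_cases hx : x ∈ K
  · by_cases hy : y ∈ K
    · simp [hx, hy, hK hx hy ha.le hb.le hab]
    · rw [Set.indicator_of_notMem hy, Real.zero_rpow hb.ne', mul_zero]
      exact hnn _
  · rw [Set.indicator_of_notMem hx, Real.zero_rpow ha.ne', zero_mul]
    exact hnn _

lemma IsLogConcave.const_mul {E : Type*} [AddCommGroup E] [Module ℝ E] {φ : E → ℝ}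
    (h : IsLogConcave φ) {c : ℝ} (hc : 0 ≤ c) : IsLogConcave fun x => c * φ x := by
  refine ⟨fun x => mul_nonneg hc (h.nonneg x), fun x y a b ha hb hab => ?_⟩
  rw [Real.mul_rpow hc (h.nonneg x), Real.mul_rpow hc (h.nonneg y), mul_mul_mul_comm,
    ← Real.rpow_add_of_nonneg hc ha.le hb.le, hab, Real.rpow_one]
  exact mul_le_mul_of_nonneg_left (h.rpow_mul_le x y a b ha hb hab) hc

/-- The pairs of a threshold `x` and a decreasing vector of exponential quantile levels at which
the `k` highest valuations sum to at least `x`. -/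
def headSumHypograph (F : Measure ℝ) (n k : ℕ) : Set (ℝ × (Fin n → ℝ)) :=
  {p | Antitone p.2 ∧ (∀ i, 0 ≤ p.2 i) ∧ p.1 ≤ headSum k (expQuantile F ∘ p.2)}

/-- The set is the hypograph of a sum of concave functions over the convex cone of nonnegative
decreasing vectors. Without the restriction to this cone, `topSum` is a maximum of such sums and
need not be concave. -/
lemma convex_headSumHypograph [NullSingletonClass F] (h0 : F (Set.Iio 0) = 0)
    (hF : IsLogConcave (survival F)) (n k : ℕ) : Convex ℝ (headSumHypograph F n k) := by
  refine convex_iff_forall_pos.2 ?_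
  rintro ⟨x, u⟩ ⟨hu, hu0, hxu⟩ ⟨y, v⟩ ⟨hv, hv0, hyv⟩ a b ha hb hab
  refine ⟨fun i j hij => ?_, fun i => ?_, ?_⟩
  · exact add_le_add (mul_le_mul_of_nonneg_left (hu hij) ha.le)
      (mul_le_mul_of_nonneg_left (hv hij) hb.le)
  · exact add_nonneg (mul_nonneg ha.le (hu0 i)) (mul_nonneg hb.le (hv0 i))
  · calc a * x + b * y ≤ a * headSum k (expQuantile F ∘ u) + b * headSum k (expQuantile F ∘ v) :=
          add_le_add (mul_le_mul_of_nonneg_left hxu ha.le) (mul_le_mul_of_nonneg_left hyv hb.le)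
      _ ≤ _ := by
          unfold headSum
          rw [Finset.mul_sum, Finset.mul_sum, ← Finset.sum_add_distrib]
          exact Finset.sum_le_sum fun j _ => expQuantile_concave h0 hF (hu0 j) (hv0 j) ha hb hab

lemma measurableSet_headSumHypograph_slice [NullSingletonClass F] (h0 : F (Set.Iio 0) = 0)
    (n k : ℕ) (x : ℝ) : MeasurableSet {v : Fin n → ℝ | (x, v) ∈ headSumHypograph F n k} := by
  have hq := (monotone_expQuantile (F := F) h0).measurable
  refine measurableSet_antitone.inter (MeasurableSet.inter ?_ ?_)
  · exact measurableSet_le measurable_const measurable_id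
  · exact measurableSet_le measurable_const ((measurable_headSum k).comp
      (measurable_pi_iff.2 fun i => hq.comp (measurable_pi_apply i)))

/-- The valuations are replaced by quantiles of exponential variables. The resulting event is
symmetric, so its probability is n! times that of its decreasing part, which is a slice of the
convex hypograph. -/
lemma survival_topSumLaw [NullSingletonClass F] (h0 : F (Set.Iio 0) = 0) (n k : ℕ) (x : ℝ) :
    survival (topSumLaw F n k) x = n.factorial *
      ∫ v, (headSumHypograph F n k).indicator (fun _ => (1 : ℝ)) (x, v)
        ∂(Measure.pi fun _ : Fin n => expLaw) := by
  have hq := monotone_expQuantile (F := F) h0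
  have hqm : Measurable fun (v : Fin n → ℝ) i => expQuantile F (v i) :=
    measurable_pi_iff.2 fun i => hq.measurable.comp (measurable_pi_apply i)
  have hlaw : valuationLaw F n = (Measure.pi fun _ : Fin n => expLaw).map
      fun v i => expQuantile F (v i) := by
    have hpush := map_expQuantile (F := F) h0
    have : SigmaFinite (expLaw.map (expQuantile F)) := by rw [hpush]; infer_instance
    rw [Measure.pi_map_pi fun _ => hq.measurable.aemeasurable, hpush]
    rfl
  have hA : MeasurableSet {v : Fin n → ℝ | x ≤ topSum k fun i => expQuantile F (v i)} :=
    measurableSet_le measurable_const ((measurable_topSum k).comp hqm)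
  have hsurv : survival (topSumLaw F n k) x = (Measure.pi fun _ : Fin n => expLaw).real
      {v | x ≤ topSum k fun i => expQuantile F (v i)} := by
    rw [survival, topSumLaw, map_measureReal_apply (measurable_topSum k) measurableSet_Ici, hlaw,
      map_measureReal_apply hqm (measurable_topSum k measurableSet_Ici)]
    rfl
  have hint : ∫ v, (headSumHypograph F n k).indicator (fun _ => (1 : ℝ)) (x, v)
      ∂(Measure.pi fun _ : Fin n => expLaw) = (Measure.pi fun _ : Fin n => expLaw).real
        {v | (x, v) ∈ headSumHypograph F n k} := by
    rw [← integral_indicator_one (measurableSet_headSumHypograph_slice h0 n k x)]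
    rfl
  have hnonneg : ∀ᵐ v ∂(Measure.pi fun _ : Fin n => expLaw), ∀ i, 0 ≤ v i := by
    rw [ae_all_iff]
    exact fun i =>
      (measurePreserving_eval (fun _ : Fin n => expLaw) i).quasiMeasurePreserving.ae
        ae_expLaw_nonneg
  have hslice : ({v : Fin n → ℝ | x ≤ topSum k fun i => expQuantile F (v i)} ∩
      {v | Antitone v} : Set (Fin n → ℝ)) =ᵐ[Measure.pi fun _ : Fin n => expLaw]
        {v | (x, v) ∈ headSumHypograph F n k} := by
    filter_upwards [hnonneg] with v hv
    apply propext
    change (x ≤ topSum k (fun i => expQuantile F (v i)) ∧ Antitone v) ↔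
      (Antitone v ∧ (∀ i, 0 ≤ v i) ∧ x ≤ headSum k (expQuantile F ∘ v))
    constructor
    · rintro ⟨h1, h2⟩
      exact ⟨h2, hv, h1.trans (topSum_of_antitone k (hq.comp_antitone h2)).le⟩
    · rintro ⟨h1, -, h2⟩
      exact ⟨h2.trans (topSum_of_antitone k (hq.comp_antitone h1)).ge, h1⟩
  rw [hsurv, hint, Measure.real, measure_eq_factorial_mul expLaw_absolutelyContinuous hA, measure_congr hslice, ENNReal.toReal_mul, ENNReal.toReal_natCast]
  · rfl
  · intro σ v
    have := topSum_comp_perm k (fun i => expQuantile F (v i)) σ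
    change x ≤ topSum k ((fun i => expQuantile F (v i)) ∘ σ) ↔ _
    rw [this]; rfl

/-- The sum of the highest valuations has a log-concave tail if the valuations have. -/
theorem isLogConcave_survival_topSumLaw [NullSingletonClass F] (h0 : F (Set.Iio 0) = 0)
    (hF : IsLogConcave (survival F)) (n k : ℕ) : IsLogConcave (survival (topSumLaw F n k)) := by
  have hprob : IsProbabilityMeasure (volume.withDensity fun x => ENNReal.ofReal (expDensity x)) :=
    inferInstanceAs (IsProbabilityMeasure expLaw)
  -- The threshold x is the parameter that remains after all n exponential variables have been
  -- integrated out.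
  have := isLogConcave_expDensity.integral_pi measurable_expDensity expDensity_le_one
    integrable_expDensity n (isLogConcave_indicator (convex_headSumHypograph h0 hF n k))
    (fun p => Set.indicator_le_self' (fun _ _ => zero_le_one) p)
    (fun x => (measurable_const.indicator (measurableSet_headSumHypograph_slice h0 n k x) :
      Measurable ({v : Fin n → ℝ | (x, v) ∈ headSumHypograph F n k}.indicator fun _ => (1 : ℝ))))
  have h2 := this.const_mul (Nat.cast_nonneg n.factorial)
  rw [show survival (topSumLaw F n k) = _ from funext (survival_topSumLaw h0 n k)]
  exact h2

/-! ### Densities of the sum and the revenue bound for the bundle. -/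

lemma exists_isDensity {μ : Measure ℝ} [IsProbabilityMeasure μ] (h : μ ≪ volume) :
    ∃ g, IsDensity μ g := by
  refine ⟨fun x => (μ.rnDeriv volume x).toReal, (μ.measurable_rnDeriv volume).ennreal_toReal,
    fun x => ENNReal.toReal_nonneg, ?_⟩
  rw [← Measure.withDensity_rnDeriv_eq μ volume h]
  refine withDensity_congr_ae ?_
  rw [Measure.withDensity_rnDeriv_eq μ volume h]
  filter_upwards [μ.rnDeriv_lt_top volume] with x hx
  rw [ENNReal.ofReal_toReal hx.ne]

lemma IsMHR.isRegular_topSumLaw (hF : ∀ᵐ x ∂F, 0 ≤ x) (h : IsMHR F) {n k : ℕ} {g : ℝ → ℝ}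
    (hg : IsDensity (topSumLaw F n k) g) : IsRegular (topSumLaw F n k) g := by
  have h0 : F (Set.Iio 0) = 0 := by
    rw [ae_iff] at hF
    simpa [Set.Iio] using hF
  have hlc := h.isLogConcave_survival
  obtain ⟨a, b, f, -, hf, -⟩ := h
  have := nullSingletonClass_of_absolutelyContinuous hf.absolutelyContinuous
  refine ⟨hg, isLogConcave_survival_topSumLaw h0 hlc n k, ?_⟩
  rw [topSumLaw, Measure.map_apply (measurable_topSum k) measurableSet_Iio]
  refine measure_mono_null (fun v hv => ?_) (ae_iff.1 (ae_valuation_nonneg hF n))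
  exact fun hv0 => absurd (topSum_nonneg k hv0) (not_le.2 hv)

/-- The revenue of the bundle at the price at which the virtual value crosses zero. -/
theorem IsRegular.optRevenue_le_revenue (hF : ∀ᵐ x ∂F, 0 ≤ x) {n k : ℕ} {g : ℝ → ℝ}
    (h : IsRegular (topSumLaw F n k) g) {p : ℝ} (hp : IsVirtualValueZero (topSumLaw F n k) g p) :
    ENNReal.ofReal (1 / Real.exp 1) * optRevenue F n k ≤
      (bundleMechanism n k p.toNNReal).revenue F := by
  have hp0 := h.isVirtualValueZero_pos hp
  have hrev : (bundleMechanism n k p.toNNReal).revenue F =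
      ENNReal.ofReal (p * survival (topSumLaw F n k) p) := by
    rw [revenue_bundleMechanism, Real.coe_toNNReal _ hp0.le, ENNReal.ofReal_mul hp0.le, survival,
      ofReal_measureReal, topSumLaw, Measure.map_apply (measurable_topSum k) measurableSet_Ici]
    rfl
  have hopt : optRevenue F n k ≤ ∫⁻ x, ENNReal.ofReal x ∂(topSumLaw F n k) := by
    rw [topSumLaw, lintegral_map (by fun_prop) (measurable_topSum k)]
    exact optRevenue_le_lintegral hF n k
  calc ENNReal.ofReal (1 / Real.exp 1) * optRevenue F n k
      ≤ ENNReal.ofReal (1 / Real.exp 1) *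
          ENNReal.ofReal (Real.exp 1 * (p * survival (topSumLaw F n k) p)) := by
        gcongr
        exact hopt.trans (h.lintegral_le hp)
    _ = (bundleMechanism n k p.toNNReal).revenue F := by
        rw [hrev, ← ENNReal.ofReal_mul (by positivity), ← mul_assoc,
          one_div_mul_cancel (Real.exp_pos 1).ne', one_mul]

end

end Monopsony

end

/-! ### The main theorem. -/

theorem mainTheorem7 (F : Measure ℝ) [IsProbabilityMeasure F] (hF : ∀ᵐ x ∂F, 0 ≤ x) :
    (Monopsony.IsMHR F → ∀ n k : ℕ, 1 ≤ k → k ≤ n →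
      (∃ g : ℝ → ℝ, Monopsony.IsDensity (Monopsony.topSumLaw F n k) g) ∧
      ∀ g : ℝ → ℝ, Monopsony.IsDensity (Monopsony.topSumLaw F n k) g →
        (∃! p : ℝ, Monopsony.IsVirtualValueZero (Monopsony.topSumLaw F n k) g p) ∧
        ∀ p : ℝ, Monopsony.IsVirtualValueZero (Monopsony.topSumLaw F n k) g p →
          0 ≤ p ∧
          (Monopsony.bundleMechanism n k p.toNNReal).IsBIC F ∧
          ENNReal.ofReal (1 / Real.exp 1) * Monopsony.optRevenue F n k ≤
            (Monopsony.bundleMechanism n k p.toNNReal).revenue F) ∧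
    (Integrable (fun x : ℝ => x) F → 0 < ∫ x, x ∂F →
      (∀ ε : ℝ, 0 < ε → ε < ∫ x, x ∂F →
        (∀ n : ℕ, (Monopsony.bundleMechanism n n
          ((n : ℝ) * ((∫ x, x ∂F) - ε)).toNNReal).IsBIC F) ∧
        Tendsto (fun n : ℕ =>
            (Monopsony.bundleMechanism n n ((n : ℝ) * ((∫ x, x ∂F) - ε)).toNNReal).revenue F /
              Monopsony.optRevenue F n n)
          atTop (𝓝 (ENNReal.ofReal (1 - ε / ∫ x, x ∂F)))) ∧
      (∀ δ : ℝ, 0 < δ → ∃ ε₀ : ℝ, 0 < ε₀ ∧ ∀ ε : ℝ, 0 < ε → ε < ε₀ →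
        ∀ᶠ n : ℕ in atTop,
          ENNReal.ofReal (1 - δ) * Monopsony.optRevenue F n n ≤
            (Monopsony.bundleMechanism n n
              ((n : ℝ) * ((∫ x, x ∂F) - ε)).toNNReal).revenue F)) := by
  refine ⟨fun h n k hk hkn => ?_, fun hint hm => ⟨fun ε hε hεm => ⟨fun n => ?_, ?_⟩, fun δ hδ => ?_⟩⟩
  · have hac : F ≪ volume := by
      obtain ⟨a, b, f, -, hf, -⟩ := h
      exact hf.absolutelyContinuous
    refine ⟨Monopsony.exists_isDensity (Monopsony.topSumLaw_absolutelyContinuous hac hk hkn),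
      fun g hg => ?_⟩
    have hreg := h.isRegular_topSumLaw hF hg
    exact ⟨hreg.existsUnique_isVirtualValueZero, fun p hp =>
      ⟨(hreg.isVirtualValueZero_pos hp).le, Monopsony.isBIC_bundleMechanism F n k _,
        hreg.optRevenue_le_revenue hF hp⟩⟩
  · exact Monopsony.isBIC_bundleMechanism F n n _
  · exact Monopsony.tendsto_revenue_div_optRevenue hF hint hm hε hεm
  · exact Monopsony.eventually_le_revenue hF hint hm hδ
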